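/- Let $N\ge 1$. Party $0$ (Alice) holds a system $A=B_0$ of $n_0$ qubits and a classical input $x=x_0$ from a finite set $\mathcal X_0$; for $p=1,\dots,N-1$, party $p$ (user $\mathcal U_p$) holds a system $B_p$ of $n_p$ qubits and a classical input $y_p=x_p$ from a finite set $\mathcal X_p$. Put $\mathcal H_{all}=\bigotimes_{p=0}^{N-1}(\mathbb C^2)^{\otimes n_p}$. **Theorem.** For every family $\{U_{x_0,\dots,x_{N-1}}\}$ of unitaries on $\mathcal H_{all}$, indexed by $\mathcal X_0\times\dots\times\mathcal X_{N-1}$, and every $\varepsilon>0$ there is $m_0\in\mathbb N$ such that for every $m\ge m_0$ the following holds. Suppose that any two distinct parties share $m$ EPR pairs $(|00\rangle+|11\rangle)/\sqrt2$. Then there are finite sets $K_0,\dots,K_{N-1}$, local quantum operations $\mathcal A^{p}_{x_p}$ ($0\le p<N$, $x_p\in\mathcal X_p$), where $\mathcal A^p_{x_p}$ acts only on $B_p$ and party $p$'s halves of its EPR pairs, outputs $n_p$ qubits (again called $B_p$) and provides a classical output $k_p\in K_p$ to party $p$, and unitaries $$V_{k_0,\dots,k_{N-1}}=\bigotimes_{p=0}^{N-1}V^{p}_{k_0,\dots,k_{N-1}},\qquad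 (k_0,\dots,k_{N-1})\in K_0\times\dots\times K_{N-1},$$ where each $V^{p}_{k_0,\dots,k_{N-1}}$ is a tensor product of $n_p$ one-qubit unitaries on $B_p$, with the following property. For every Hilbert space $\mathcal H_E$, every unit vector $|\psi\rangle\in\mathcal H_{all}\otimes\mathcal H_E$ and all inputs $(x_0,\dots,x_{N-1})$: if the joint operation $\bigotimes_p\mathcal A^p_{x_p}$ (no communication) is applied to $|\psi\rangle$ and the shared EPR pairs, and $|\varphi'\rangle\in\mathcal H_{all}\otimes\mathcal H_E$ denotes the resulting state given the classical outputs $(k_0,\dots,k_{N-1})$, then, except with probability at most $\varepsilon$ over these outputs, $$(V_{k_0,\dots,k_{N-1}}\otimes\mathbb I)\,|\varphi'\rangle=(U_{x_0,\dots,x_{N-1}}\otimes\mathbb I)\,|\psi\rangle$$ up to a global phase. -/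

import Mathlib

open scoped Matrix

universe u v

/-- Labels of the computational basis of a register whose qubits are indexed by `ι`. -/
abbrev Bits (ι : Type*) : Type _ := ι → Fin 2

/-- The Hilbert space `ℂ^ι ⊗ E` for a finite set `ι` of basis labels: a vector is given by its
`E`-valued coordinates, with `‖ψ‖² = ∑ i, ‖ψ i‖²`. -/
abbrev StateSpace (ι : Type*) (E : Type*) : Type _ := PiLp 2 (fun _ : ι => E)

section
variable {ι κ E : Type*} [Fintype ι] [AddCommGroup E] [Module ℂ E]

/-- The action of `M ⊗ 𝟙_E` on `ℂ^ι ⊗ E`. -/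
def applyMatrix (M : Matrix κ ι ℂ) (ψ : StateSpace ι E) : StateSpace κ E :=
  WithLp.toLp 2 fun a => ∑ i, M a i • ψ i

end

/-- The tensor product `⨂ p, M p` of finitely many matrices, in product-basis coordinates. -/
def tensorMatrix {P : Type*} [Fintype P] {ι κ : P → Type*} (M : ∀ p, Matrix (κ p) (ι p) ℂ) :
    Matrix (∀ p, κ p) (∀ p, ι p) ℂ :=
  fun a b => ∏ p, M p (a p) (b p)

/-- The qubits of party `p` that stem from shared EPR pairs, when any two of the `N` parties share
`m` EPR pairs: `(q, i)` is the half held by `p` of the `i`-th pair shared by `p` and `q`. -/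
abbrev Halves (N m : ℕ) (p : Fin N) : Type := {q : Fin N // q ≠ p} × Fin m

/-- The amplitudes of the EPR pair `(|00⟩ + |11⟩) / √2`. -/
noncomputable def eprPair (a b : Fin 2) : ℂ := if a = b then ((1 / Real.sqrt 2 : ℝ) : ℂ) else 0

/-- The amplitudes of the tensor product of all shared EPR pairs: `m` pairs for every pair
`p < q` of parties. -/
noncomputable def eprState (N m : ℕ) (h : ∀ p, Bits (Halves N m p)) : ℂ :=
  ∏ e : {e : Fin N × Fin N // e.1 < e.2}, ∏ i : Fin m,
    eprPair (h e.1.1 (⟨e.1.2, e.2.ne'⟩, i)) (h e.1.2 (⟨e.1.1, e.2.ne⟩, i))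

/-- Basis labels of the quantum output register of a party with `r` data qubits. -/
abbrev DataReg (r : ℕ) : Type := Bits (Fin r)

/-- Basis labels of everything that party `p` holds at the start: its data qubits and its halves
of the shared EPR pairs. -/
abbrev LocalReg (N m : ℕ) (n : Fin N → ℕ) (p : Fin N) : Type :=
  DataReg (n p) × Bits (Halves N m p)

/-- `|ψ⟩ ⊗ |EPR pairs⟩`, with the factors regrouped party by party. -/
noncomputable def withEPR {N : ℕ} (m : ℕ) {n : Fin N → ℕ} {E : Type*} [AddCommGroup E] [Module ℂ E]
    (ψ : StateSpace (∀ p, DataReg (n p)) E) : StateSpace (∀ p, LocalReg N m n p) E :=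
  WithLp.toLp 2 fun s => eprState N m (fun p => (s p).2) • ψ fun p => (s p).1

/-- A quantum operation from `ℂ^ι` to `ℂ^κ` with classical output in `K`, given by measurement
operators: on output `k` the (unnormalized) state `v` is sent to `kraus k v`, and `‖kraus k v‖²` is
the probability of this output. (Every quantum operation with a classical output has this form
after enlarging the classical output.) -/
structure QuantumOperation (K ι κ : Type*) [Fintype K] [Fintype ι] [DecidableEq ι]
    [Fintype κ] where
  kraus : K → Matrix κ ι ℂ
  complete : ∑ k, (kraus k)ᴴ * kraus k = 1

section
variable {N m : ℕ} {n : Fin N → ℕ} {K : Fin N → Type} [∀ p, Fintype (K p)]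
  {E : Type*} [NormedAddCommGroup E] [InnerProductSpace ℂ E]

/-- The unnormalized joint state `|φ'⟩` after the joint execution `⨂ p, A p` on `|ψ⟩` and the shared
EPR pairs, when the classical outputs are `k`. Its squared norm is the probability of `k`. -/
noncomputable def jointOutput
    (A : ∀ p, QuantumOperation (K p) (LocalReg N m n p) (DataReg (n p)))
    (ψ : StateSpace (∀ p, DataReg (n p)) E) (k : ∀ p, K p) :
    StateSpace (∀ p, DataReg (n p)) E :=
  applyMatrix (tensorMatrix fun p => (A p).kraus (k p)) (withEPR m ψ)

/-- The local qubit-wise unitary `⨂ p, ⨂ j, V p j`, where `V p j` acts on the `j`-th data qubit of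
party `p`. -/
def qubitwise (V : ∀ p, Fin (n p) → Matrix.unitaryGroup (Fin 2) ℂ) :
    Matrix (∀ p, DataReg (n p)) (∀ p, DataReg (n p)) ℂ :=
  tensorMatrix fun p => tensorMatrix fun j => (V p j : Matrix (Fin 2) (Fin 2) ℂ)

/-- `(V ⊗ 𝟙)|φ'⟩` and `|φ⟩` are the same quantum state; the scalar accounts for the missing
normalization of `φ'` and for a global phase. -/
def CoincidesUpTo (V : ∀ p, Fin (n p) → Matrix.unitaryGroup (Fin 2) ℂ)
    (φ' φ : StateSpace (∀ p, DataReg (n p)) E) : Prop :=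
  ∃ c : ℂ, applyMatrix (qubitwise V) φ' = c • φ

open Classical in
/-- The probability that the classical outputs `k` of the joint execution of the `A p` on `ψ` are
such that the resulting state does not coincide with `φ` up to the qubit-wise unitary `V k`. -/
noncomputable def failureProb
    (A : ∀ p, QuantumOperation (K p) (LocalReg N m n p) (DataReg (n p)))
    (V : (∀ p, K p) → ∀ p, Fin (n p) → Matrix.unitaryGroup (Fin 2) ℂ)
    (ψ φ : StateSpace (∀ p, DataReg (n p)) E) : ℝ :=
  ∑ k ∈ Finset.univ.filter fun k : ∀ p, K p => ¬ CoincidesUpTo (V k) (jointOutput A ψ k) φ,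
    ‖jointOutput A ψ k‖ ^ 2

end

/-! Teleportation moves a qubit without communication, up to a Pauli operator known only to the
sender. Pauli operators are one-qubit unitaries, so errors that arise after the computation are
allowed in the conclusion (`Solvable.teleOut`); only errors before it matter, and there the Bell
outcomes merely become further classical inputs (`Solvable.teleIn`). Gathering all qubits `J` at one
party `p` therefore reduces the theorem to one task: perform `W z` on qubits at `p`, where the input
`z` is distributed over the parties.

This task is attacked in rounds (`SolvableUpTo.round`). The qubits visit every party once. Each
holder uses its own input to select one of several parallel copies of the rest of the protocol
(`Solvable.select`), so that inside a copy this input is a constant. In the copy reached by the last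
holder, `W z` is a fixed unitary `F`, which that party applies. If all `N - 1` teleportations had
trivial outcomes, which has probability `4 ^ (-|J| (N - 1))`, nothing remains to be done. Otherwise
an accumulated error `Q` leaves the task `F * Q * F⁻¹`, which is again a computation on qubits at
one party with distributed inputs. One more round thus multiplies the failure bound by `1 - 4 ^
(-|J| (N - 1))`, and the powers of this number tend to `0`.

No party knows whether a round has already succeeded, so the later rounds are always executed and
must not spoil a finished computation. Hence `SolvableUpTo` demands error `0` whenever the task is a
tensor product of one-qubit unitaries.

In `Solvable` a successful outcome has joint operator `c • (V * W z)` with `V` local. Its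
probability `‖c‖ ^ 2` does not depend on the state, so entanglement with a further system is
harmless. The EPR pairs that a protocol consumes are finally extracted from the given ones by local
operations (`IsLinkState.exists_extraction`). -/

set_option synthInstance.maxSize 2000

/-! ### Tensor products of matrices, their action on states, conservation of probability -/

section TensorMatrix
variable {P : Type*} [Fintype P] {ι κ μ : P → Type*}

theorem tensorMatrix_mul [DecidableEq P] [∀ p, Fintype (κ p)] (A : ∀ p, Matrix (ι p) (κ p) ℂ)
    (B : ∀ p, Matrix (κ p) (μ p) ℂ) :
    tensorMatrix A * tensorMatrix B = tensorMatrix fun p => A p * B p := by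
  ext a b
  simp only [Matrix.mul_apply, tensorMatrix, ← Finset.prod_mul_distrib]
  exact (Fintype.prod_sum fun p j => A p (a p) j * B p j (b p)).symm

theorem tensorMatrix_conjTranspose (A : ∀ p, Matrix (ι p) (κ p) ℂ) :
    (tensorMatrix A)ᴴ = tensorMatrix fun p => (A p)ᴴ := by
  ext a b
  simp [tensorMatrix, Matrix.conjTranspose_apply]

theorem tensorMatrix_one [∀ p, DecidableEq (ι p)] [DecidableEq (∀ p, ι p)] :
    tensorMatrix (fun p => (1 : Matrix (ι p) (ι p) ℂ)) = 1 := by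
  ext a b
  simp only [tensorMatrix, Matrix.one_apply, funext_iff, Fintype.prod_boole]

theorem sum_tensorMatrix [DecidableEq P] {K : P → Type*} [∀ p, Fintype (K p)]
    (A : ∀ p, K p → Matrix (ι p) (κ p) ℂ) :
    ∑ k : ∀ p, K p, tensorMatrix (fun p => A p (k p)) = tensorMatrix fun p => ∑ k, A p k := by
  ext a b
  simp only [tensorMatrix, Matrix.sum_apply]
  exact (Fintype.prod_sum fun p k => A p k (a p) (b p)).symm

/-- The tensor product of unitaries, as a group homomorphism. -/
def tensorUnitary [DecidableEq P] [∀ p, Fintype (ι p)] [∀ p, DecidableEq (ι p)] :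
    (∀ p, Matrix.unitaryGroup (ι p) ℂ) →* Matrix.unitaryGroup (∀ p, ι p) ℂ where
  toFun A := ⟨tensorMatrix fun p => (A p : Matrix (ι p) (ι p) ℂ), by
    rw [Matrix.mem_unitaryGroup_iff, Matrix.star_eq_conjTranspose, tensorMatrix_conjTranspose,
      tensorMatrix_mul]
    have h : ∀ p, (A p : Matrix (ι p) (ι p) ℂ) * (A p : Matrix (ι p) (ι p) ℂ)ᴴ = 1 := fun p =>
      Matrix.mem_unitaryGroup_iff.1 (A p).2
    simp only [h, tensorMatrix_one]⟩
  map_one' := Subtype.ext tensorMatrix_one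
  map_mul' A B := Subtype.ext (tensorMatrix_mul _ _).symm

@[simp] theorem coe_tensorUnitary [DecidableEq P] [∀ p, Fintype (ι p)] [∀ p, DecidableEq (ι p)]
    (A : ∀ p, Matrix.unitaryGroup (ι p) ℂ) :
    (tensorUnitary A : Matrix (∀ p, ι p) (∀ p, ι p) ℂ) =
      tensorMatrix fun p => (A p : Matrix (ι p) (ι p) ℂ) := rfl

end TensorMatrix

/-- Relabelling the basis of a unitary. -/
def reindexUnitary {α β : Type*} [Fintype α] [DecidableEq α] [Fintype β] [DecidableEq β]
    (e : α ≃ β) : Matrix.unitaryGroup α ℂ →* Matrix.unitaryGroup β ℂ where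
  toFun U := ⟨(U : Matrix α α ℂ).submatrix e.symm e.symm, by
    rw [Matrix.mem_unitaryGroup_iff, Matrix.star_eq_conjTranspose, Matrix.conjTranspose_submatrix,
      Matrix.submatrix_mul_equiv, ← Matrix.star_eq_conjTranspose, Matrix.mem_unitaryGroup_iff.1 U.2]
    simp⟩
  map_one' := Subtype.ext (by simp)
  map_mul' U V := Subtype.ext (Matrix.submatrix_mul_equiv _ _ _ _ _).symm

@[simp] theorem coe_reindexUnitary {α β : Type*} [Fintype α] [DecidableEq α] [Fintype β]
    [DecidableEq β] (e : α ≃ β) (U : Matrix.unitaryGroup α ℂ) :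
    (reindexUnitary e U : Matrix β β ℂ) = (U : Matrix α α ℂ).submatrix e.symm e.symm := rfl

section ApplyMatrix
variable {ι κ μ K E : Type*} [Fintype ι]

theorem applyMatrix_mul [Fintype κ] [AddCommGroup E] [Module ℂ E] (A : Matrix μ κ ℂ) (B : Matrix κ ι ℂ)
    (ψ : StateSpace ι E) : applyMatrix (A * B) ψ = applyMatrix A (applyMatrix B ψ) := by
  ext a
  simp only [applyMatrix, Matrix.mul_apply, Finset.sum_smul, Finset.smul_sum, smul_smul]
  exact Finset.sum_comm

theorem applyMatrix_smul [AddCommGroup E] [Module ℂ E] (c : ℂ) (A : Matrix κ ι ℂ)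
    (ψ : StateSpace ι E) : applyMatrix (c • A) ψ = c • applyMatrix A ψ := by
  ext a
  simp [applyMatrix, Finset.smul_sum, smul_smul]

theorem applyMatrix_one [DecidableEq ι] [AddCommGroup E] [Module ℂ E]
    (ψ : StateSpace ι E) : applyMatrix 1 ψ = ψ := by
  ext a
  simp [applyMatrix, Matrix.one_apply]

variable [NormedAddCommGroup E] [InnerProductSpace ℂ E]

/-- Conservation of probability: after expanding the norms into inner products, completeness cancels
all off-diagonal terms. The identity is proved in `ℂ`, where the inner products live, and cast back.
-/
theorem sum_norm_sq_applyMatrix [Fintype κ] [Fintype K] [DecidableEq ι] (M : K → Matrix κ ι ℂ)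
    (hM : ∑ k, (M k)ᴴ * M k = 1) (ψ : StateSpace ι E) :
    ∑ k, ‖applyMatrix (M k) ψ‖ ^ 2 = ‖ψ‖ ^ 2 := by
  have key : ∀ i j, ∑ k, ∑ a, star (M k a i) * M k a j = if i = j then 1 else 0 := by
    intro i j
    have := congrFun (congrFun hM i) j
    simpa [Matrix.sum_apply, Matrix.mul_apply, Matrix.one_apply] using this
  have h : ((∑ k, ‖applyMatrix (M k) ψ‖ ^ 2 : ℝ) : ℂ) = ((‖ψ‖ ^ 2 : ℝ) : ℂ) := by
    simp only [PiLp.norm_sq_eq_of_L2, applyMatrix]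
    push_cast
    have e : ∀ x : E, ((‖x‖ : ℂ)) ^ 2 = inner ℂ x x := fun x => (inner_self_eq_norm_sq_to_K x).symm
    simp only [e, sum_inner, inner_sum, inner_smul_left, inner_smul_right]
    calc ∑ k, ∑ a, ∑ j, M k a j * ∑ i, starRingEnd ℂ (M k a i) * inner ℂ (ψ i) (ψ j)
        = ∑ j, ∑ i, (∑ k, ∑ a, star (M k a i) * M k a j) * inner ℂ (ψ i) (ψ j) := by
          simp only [Finset.sum_mul, Finset.mul_sum]
          rw [Finset.sum_congr rfl fun k _ => Finset.sum_comm, Finset.sum_comm]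
          refine Finset.sum_congr rfl fun i _ => ?_
          rw [Finset.sum_congr rfl fun k _ => Finset.sum_comm, Finset.sum_comm]
          refine Finset.sum_congr rfl fun j _ => Finset.sum_congr rfl fun k _ =>
            Finset.sum_congr rfl fun a _ => ?_
          simp only [starRingEnd_apply]
          ring
      _ = ∑ i, inner ℂ (ψ i) (ψ i) := by
          simp only [key, ite_mul, one_mul, zero_mul, Finset.sum_ite_eq',
            Finset.mem_univ, if_true]
  exact_mod_cast h

theorem norm_applyMatrix_unitary [DecidableEq ι] (M : Matrix.unitaryGroup ι ℂ)
    (ψ : StateSpace ι E) : ‖applyMatrix (M : Matrix ι ι ℂ) ψ‖ = ‖ψ‖ := by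
  have := sum_norm_sq_applyMatrix (K := Unit) (fun _ => (M : Matrix ι ι ℂ))
    (by simpa [Matrix.star_eq_conjTranspose] using Matrix.mem_unitaryGroup_iff'.1 M.2) ψ
  simpa using this

end ApplyMatrix

section LocalOperations
variable {P : Type*} [Fintype P] [DecidableEq P] {K ι κ : P → Type*} [∀ p, Fintype (K p)]
  [∀ p, Fintype (ι p)] [∀ p, DecidableEq (ι p)] [∀ p, Fintype (κ p)]

/-- Local operations form a complete joint operation because the sum over all outcome tuples
factorizes over the parties. -/
theorem sum_norm_sq_tensorMatrix {E : Type*} [NormedAddCommGroup E] [InnerProductSpace ℂ E]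
    (A : ∀ p, QuantumOperation (K p) (ι p) (κ p)) (ψ : StateSpace (∀ p, ι p) E) :
    ∑ k : ∀ p, K p, ‖applyMatrix (tensorMatrix fun p => (A p).kraus (k p)) ψ‖ ^ 2 = ‖ψ‖ ^ 2 := by
  refine sum_norm_sq_applyMatrix _ ?_ ψ
  simp only [tensorMatrix_conjTranspose, tensorMatrix_mul]
  rw [sum_tensorMatrix (fun p k => ((A p).kraus k)ᴴ * (A p).kraus k)]
  simp only [(A _).complete, tensorMatrix_one]

end LocalOperations

theorem QuantumOperation.sum_star_mul {K ι κ : Type*} [Fintype K] [Fintype ι] [DecidableEq ι]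
    [Fintype κ] (A : QuantumOperation K ι κ) (i j : ι) :
    ∑ k, ∑ a, star (A.kraus k a i) * A.kraus k a j = if i = j then 1 else 0 := by
  have := congrFun (congrFun A.complete i) j
  simpa [Matrix.sum_apply, Matrix.mul_apply, Matrix.one_apply] using this

/-- A quantum operation from a family of matrices that is complete entry by entry. -/
def QuantumOperation.ofEntries {K ι κ : Type*} [Fintype K] [Fintype ι] [DecidableEq ι]
    [Fintype κ] (M : K → Matrix κ ι ℂ)
    (h : ∀ i j, ∑ k, ∑ a, star (M k a i) * M k a j = if i = j then 1 else 0) :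
    QuantumOperation K ι κ where
  kraus := M
  complete := by
    ext i j
    simpa [Matrix.sum_apply, Matrix.mul_apply, Matrix.one_apply] using h i j

/-! ### Pauli operators, Bell measurements and teleportation -/

section Pauli

/-- The Pauli operator `X ^ a.1 * Z ^ a.2`. -/
def pauliMatrix (a : Fin 2 × Fin 2) : Matrix (Fin 2) (Fin 2) ℂ :=
  fun i j => if i = j + a.1 then (if a.2 = 1 ∧ j = 1 then -1 else 1) else 0

/-- The Pauli operators as unitaries. -/
def pauli (a : Fin 2 × Fin 2) : Matrix.unitaryGroup (Fin 2) ℂ :=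
  ⟨pauliMatrix a, by
    rw [Matrix.mem_unitaryGroup_iff]
    obtain ⟨a, b⟩ := a
    ext i j
    fin_cases a <;> fin_cases b <;> fin_cases i <;> fin_cases j <;>
      simp [pauliMatrix, Matrix.mul_apply]⟩

theorem pauli_zero : pauli 0 = 1 := by
  ext i j
  fin_cases i <;> fin_cases j <;> simp [pauli, pauliMatrix]

/-- The Pauli operators are an orthogonal basis of the `2 × 2` matrices; this is the completeness of
the one-qubit Bell measurement. -/
theorem sum_star_pauliMatrix_mul (i j i' j' : Fin 2) :
    ∑ a, star (pauliMatrix a i j) * pauliMatrix a i' j' = if i = i' ∧ j = j' then 2 else 0 := by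
  rw [Fintype.sum_prod_type]
  fin_cases i <;> fin_cases j <;> fin_cases i' <;> fin_cases j' <;>
    simp [pauliMatrix] <;> norm_num

/-- The amplitudes of the Bell basis of two registers with qubits `J`. -/
noncomputable def bell {J : Type*} [Fintype J] (a : J → Fin 2 × Fin 2) (s u : Bits J) : ℂ :=
  ∏ j, ((1 / Real.sqrt 2 : ℝ) : ℂ) * pauliMatrix (a j) (u j) (s j)

theorem inv_sqrt_two_mul_self :
    ((1 / Real.sqrt 2 : ℝ) : ℂ) * ((1 / Real.sqrt 2 : ℝ) : ℂ) = 1 / 2 := by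
  rw [← Complex.ofReal_mul, div_mul_div_comm, Real.mul_self_sqrt (by norm_num)]
  norm_num

theorem sum_star_bell_mul {J : Type*} [Fintype J] [DecidableEq J] (s u s' u' : Bits J) :
    ∑ a : J → Fin 2 × Fin 2, star (bell a s u) * bell a s' u' =
      if s = s' ∧ u = u' then 1 else 0 := by
  simp only [bell, star_prod, ← Finset.prod_mul_distrib]
  rw [← Fintype.prod_sum (fun j a => star (((1 / Real.sqrt 2 : ℝ) : ℂ) *
    pauliMatrix a (u j) (s j)) * (((1 / Real.sqrt 2 : ℝ) : ℂ) * pauliMatrix a (u' j) (s' j)))]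
  have h : ∀ j, ∑ a, star (((1 / Real.sqrt 2 : ℝ) : ℂ) * pauliMatrix a (u j) (s j)) *
      (((1 / Real.sqrt 2 : ℝ) : ℂ) * pauliMatrix a (u' j) (s' j)) =
        if s j = s' j ∧ u j = u' j then 1 else 0 := by
    intro j
    have e : ∀ a, star (((1 / Real.sqrt 2 : ℝ) : ℂ) * pauliMatrix a (u j) (s j)) *
      (((1 / Real.sqrt 2 : ℝ) : ℂ) * pauliMatrix a (u' j) (s' j)) =
        1 / 2 * (star (pauliMatrix a (u j) (s j)) * pauliMatrix a (u' j) (s' j)) := by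
      intro a
      rw [← inv_sqrt_two_mul_self, star_mul']
      have : star ((1 / Real.sqrt 2 : ℝ) : ℂ) = ((1 / Real.sqrt 2 : ℝ) : ℂ) := Complex.conj_ofReal _
      rw [this]
      ring
    simp only [e, ← Finset.mul_sum, sum_star_pauliMatrix_mul]
    by_cases h1 : s j = s' j <;> by_cases h2 : u j = u' j <;> simp [h1, h2]
  simp only [h, Fintype.prod_boole, funext_iff, forall_and]

theorem eprPair_comm (a b : Fin 2) : eprPair a b = eprPair b a := by
  simp only [eprPair, eq_comm]

theorem sum_norm_sq_eprPair : ∑ q : Fin 2 × Fin 2, ‖eprPair q.1 q.2‖ ^ 2 = 1 := by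
  rw [Fintype.sum_prod_type]
  simp [eprPair]
  norm_num

/-- Contracting a Bell measurement with EPR pairs is a teleportation: it applies a Pauli
operator and a factor `1 / 2` for every qubit. -/
theorem sum_bell_mul_eprPair {J : Type*} [Fintype J] [DecidableEq J] (a : J → Fin 2 × Fin 2)
    (s v : Bits J) :
    ∑ u : Bits J, bell a s u * ∏ j, eprPair (u j) (v j) =
      (1 / 2) ^ Fintype.card J * tensorMatrix (fun j => pauliMatrix (a j)) v s := by
  rw [Fintype.sum_eq_single v]
  · simp only [bell, ← Finset.prod_mul_distrib, tensorMatrix]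
    rw [← Finset.card_univ, ← Finset.prod_const, ← Finset.prod_mul_distrib]
    refine Finset.prod_congr rfl fun j _ => ?_
    rw [← inv_sqrt_two_mul_self]
    simp only [eprPair, if_true]
    ring
  · intro u hu
    obtain ⟨j, hj⟩ := Function.ne_iff.1 hu
    rw [Finset.prod_eq_zero (Finset.mem_univ j) (by simp [eprPair, hj]), mul_zero]

end Pauli

/-! ### Shared states made of EPR pairs -/

section LinkStates
variable {N : ℕ}

/-- The part of the string `s` that is located at `x`, when its `j`-th entry is at `ℓ j`. -/
def localPart {J α : Type*} (ℓ : J → Fin N) (s : J → α) (x : Fin N) : {j // ℓ j = x} → α :=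
  fun j => s j

/-- A string is given by its parts at the different locations. -/
def splitEquiv {J : Type*} (α : Type*) (ℓ : J → Fin N) :
    (J → α) ≃ ∀ x, {j // ℓ j = x} → α where
  toFun := localPart ℓ
  invFun f j := f (ℓ j) ⟨j, rfl⟩
  left_inv _ := rfl
  right_inv f := by
    funext x j
    obtain ⟨j, rfl⟩ := j
    rfl

theorem prod_localPart {J : Type*} [Fintype J] {M : Type*} [CommMonoid M] (ℓ : J → Fin N)
    (f : J → M) : ∏ x, ∏ j, localPart ℓ f x j = ∏ j, f j :=
  Fintype.prod_fiberwise ℓ f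

/-- The amplitudes of EPR pairs indexed by `I`, where the halves of the `i`-th pair are
at `src i` and at `tgt i`. -/
noncomputable def linkState {I : Type*} [Fintype I] (src tgt : I → Fin N)
    (r : ∀ x, Bits {i // src i = x} × Bits {i // tgt i = x}) : ℂ :=
  ∏ i, eprPair ((r (src i)).1 ⟨i, rfl⟩) ((r (tgt i)).2 ⟨i, rfl⟩)

/-- A shared state that consists of EPR pairs, up to a relabelling of the local bases. -/
def IsLinkState {R : Fin N → Type} (ρ : (∀ x, R x) → ℂ) : Prop :=
  ∃ (I : Type) (_ : Fintype I) (_ : DecidableEq I) (src tgt : I → Fin N)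
    (e : ∀ x, R x ≃ Bits {i // src i = x} × Bits {i // tgt i = x}),
    ∀ r, ρ r = linkState src tgt fun x => e x (r x)

theorem IsLinkState.sum_norm_sq {R : Fin N → Type} [∀ x, Fintype (R x)] {ρ : (∀ x, R x) → ℂ}
    (h : IsLinkState ρ) : ∑ r, ‖ρ r‖ ^ 2 = 1 := by
  obtain ⟨I, _, _, src, tgt, e, h⟩ := h
  let f : (∀ x, Bits {i // src i = x} × Bits {i // tgt i = x}) ≃ (I → Fin 2 × Fin 2) :=
    { toFun := fun r i => ((r (src i)).1 ⟨i, rfl⟩, (r (tgt i)).2 ⟨i, rfl⟩)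
      invFun := fun g x => (fun i => (g i).1, fun i => (g i).2)
      left_inv := fun r => by
        funext x
        refine Prod.ext (funext fun i => ?_) (funext fun i => ?_) <;> obtain ⟨i, rfl⟩ := i <;> rfl
      right_inv := fun _ => rfl }
  rw [Fintype.sum_equiv ((Equiv.piCongrRight e).trans f) _
    (fun g => ∏ i, ‖eprPair (g i).1 (g i).2‖ ^ 2)]
  · rw [← Fintype.prod_sum (fun (_ : I) (q : Fin 2 × Fin 2) => ‖eprPair q.1 q.2‖ ^ 2)]
    simp [sum_norm_sq_eprPair]
  · intro r
    rw [h, linkState, norm_prod, Finset.prod_pow]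
    rfl

theorem isLinkState_linkState {I : Type} [Fintype I] [DecidableEq I] (src tgt : I → Fin N) :
    IsLinkState (linkState src tgt) :=
  ⟨I, _, inferInstance, src, tgt, fun _ => Equiv.refl _, fun _ => rfl⟩

theorem isLinkState_one : IsLinkState (fun _ : ∀ _ : Fin N, Unit => (1 : ℂ)) := by
  refine ⟨Empty, inferInstance, inferInstance, Empty.elim, Empty.elim, fun x =>
    { toFun := fun _ => (fun i => i.1.elim, fun i => i.1.elim)
      invFun := fun _ => ()
      left_inv := fun _ => rfl
      right_inv := fun _ => Prod.ext (funext fun i => i.1.elim) (funext fun i => i.1.elim) },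
    fun r => ?_⟩
  simp [linkState]

/-- Protocols that are composed or run in parallel need the product of their resources; the links
are put side by side. -/
theorem IsLinkState.mul {R R' : Fin N → Type} {ρ : (∀ x, R x) → ℂ} {ρ' : (∀ x, R' x) → ℂ}
    (h : IsLinkState ρ) (h' : IsLinkState ρ') :
    IsLinkState (fun r : ∀ x, R x × R' x => ρ (fun x => (r x).1) * ρ' (fun x => (r x).2)) := by
  obtain ⟨I, _, _, src, tgt, e, h⟩ := h
  obtain ⟨I', _, _, src', tgt', e', h'⟩ := h'
  refine ⟨I ⊕ I', inferInstance, inferInstance, Sum.elim src src', Sum.elim tgt tgt', fun x =>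
    ((e x).prodCongr (e' x)).trans
      { toFun := fun r =>
          (fun i => match i with
            | ⟨.inl i, hi⟩ => r.1.1 ⟨i, hi⟩
            | ⟨.inr i, hi⟩ => r.2.1 ⟨i, hi⟩,
          fun i => match i with
            | ⟨.inl i, hi⟩ => r.1.2 ⟨i, hi⟩
            | ⟨.inr i, hi⟩ => r.2.2 ⟨i, hi⟩)
        invFun := fun r => ((fun i => r.1 ⟨.inl i, i.2⟩, fun i => r.2 ⟨.inl i, i.2⟩),
          (fun i => r.1 ⟨.inr i, i.2⟩, fun i => r.2 ⟨.inr i, i.2⟩))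
        left_inv := fun _ => rfl
        right_inv := fun r => by
          refine Prod.ext (funext fun i => ?_) (funext fun i => ?_) <;>
            rcases i with ⟨i | i, hi⟩ <;> rfl }, fun r => ?_⟩
  beta_reduce
  rw [h, h', linkState, linkState, linkState, Fintype.prod_sum_type]
  rfl

theorem IsLinkState.pi {C : Type} [Fintype C] [DecidableEq C] {R : C → Fin N → Type}
    {ρ : ∀ c, (∀ x, R c x) → ℂ} (h : ∀ c, IsLinkState (ρ c)) :
    IsLinkState (fun r : ∀ x, ∀ c, R c x => ∏ c, ρ c (fun x => r x c)) := by
  choose I fI dI src tgt e h using h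
  refine ⟨Σ c, I c, inferInstance, inferInstance, fun i => src i.1 i.2, fun i => tgt i.1 i.2,
    fun x => (Equiv.piCongrRight fun c => e c x).trans
      { toFun := fun r =>
          (fun i => (r i.1.1).1 ⟨i.1.2, i.2⟩, fun i => (r i.1.1).2 ⟨i.1.2, i.2⟩)
        invFun := fun r c => (fun i => r.1 ⟨⟨c, i⟩, i.2⟩, fun i => r.2 ⟨⟨c, i⟩, i.2⟩)
        left_inv := fun _ => rfl
        right_inv := fun _ => rfl }, fun r => ?_⟩
  simp only [h, linkState, Fintype.prod_sigma]
  rfl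

end LinkStates

/-! ### Protocols without communication -/

section Protocols
variable {N : ℕ} {J : Type} [Fintype J] [DecidableEq J]

/-- A protocol without communication for parties that share EPR pairs. The qubits `J` are at
`ℓ` before and at `ℓ'` after the execution, and party `x` has a classical input in `Z x`. -/
structure Protocol (ℓ ℓ' : J → Fin N) (Z : Fin N → Type) where
  R : Fin N → Type
  [fintypeR : ∀ x, Fintype (R x)]
  [decidableEqR : ∀ x, DecidableEq (R x)]
  state : (∀ x, R x) → ℂ
  isLinkState : IsLinkState state
  K : Fin N → Type
  [fintypeK : ∀ x, Fintype (K x)]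
  op : ∀ x, Z x → QuantumOperation (K x) (Bits {j // ℓ j = x} × R x) (Bits {j // ℓ' j = x})

attribute [instance] Protocol.fintypeR Protocol.decidableEqR Protocol.fintypeK

/-- The joint measurement operator of a protocol on the qubits `J`. -/
def Protocol.eff {ℓ ℓ' : J → Fin N} {Z : Fin N → Type} (A : Protocol ℓ ℓ' Z) (z : ∀ x, Z x)
    (k : ∀ x, A.K x) : Matrix (Bits J) (Bits J) ℂ :=
  fun t s => ∑ r, A.state r *
    ∏ x, (A.op x (z x)).kraus (k x) (localPart ℓ' t x) (localPart ℓ s x, r x)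

/-- Conservation of probability for a basis state as input. It shows that copies that are not
selected and run on `|0⟩` have no influence on the success probability. -/
theorem Protocol.sum_norm_sq_eff {ℓ ℓ' : J → Fin N} {Z : Fin N → Type} (A : Protocol ℓ ℓ' Z)
    (z : ∀ x, Z x) (s : Bits J) : ∑ k, ∑ t, ‖A.eff z k t s‖ ^ 2 = 1 := by
  let ψ : StateSpace (∀ x, Bits {j // ℓ j = x} × A.R x) ℂ :=
    WithLp.toLp 2 fun q => if (fun x => (q x).1) = localPart ℓ s then A.state fun x => (q x).2
      else 0
  let e : (∀ x, Bits {j // ℓ j = x} × A.R x) ≃ (∀ x, Bits {j // ℓ j = x}) × ∀ x, A.R x :=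
    { toFun := fun q => (fun x => (q x).1, fun x => (q x).2)
      invFun := fun q x => (q.1 x, q.2 x)
      left_inv := fun _ => rfl
      right_inv := fun _ => rfl }
  have h := sum_norm_sq_tensorMatrix (fun x => A.op x (z x)) ψ
  have h1 : ‖ψ‖ ^ 2 = 1 := by
    rw [PiLp.norm_sq_eq_of_L2, Fintype.sum_equiv e _ (fun q => if q.1 = localPart ℓ s then
      ‖A.state q.2‖ ^ 2 else 0), Fintype.sum_prod_type]
    · simp [A.isLinkState.sum_norm_sq, Finset.sum_ite_irrel]
    · intro q
      simp only [ψ, e, Equiv.coe_fn_mk]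
      split_ifs <;> simp
  rw [h1] at h
  rw [← h]
  refine Finset.sum_congr rfl fun k _ => ?_
  rw [PiLp.norm_sq_eq_of_L2]
  refine Fintype.sum_equiv (splitEquiv (Fin 2) ℓ') _ _ fun t => ?_
  congr 2
  change _ = ∑ i, tensorMatrix (fun x => (A.op x (z x)).kraus (k x)) (localPart ℓ' t) i • ψ i
  rw [Fintype.sum_equiv e _ (fun q => tensorMatrix
    (fun x => (A.op x (z x)).kraus (k x)) (localPart ℓ' t) (e.symm q) •
      if q.1 = localPart ℓ s then A.state q.2 else 0), Fintype.sum_prod_type,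
      Fintype.sum_eq_single (localPart ℓ s)]
  · simp [Protocol.eff, tensorMatrix, e, mul_comm]
  · intro q hq
    simp [hq]
  · intro q
    rfl

/-- The tensor products of one-qubit unitaries. -/
def localUnitaries (J : Type) [Fintype J] [DecidableEq J] :
    Subgroup (Matrix.unitaryGroup (Bits J) ℂ) :=
  (tensorUnitary (ι := fun _ : J => Fin 2)).range

/-- There is a protocol that brings the qubits from `ℓ` to `ℓ'` and performs `W z` up to one-qubit
unitaries, except with probability at most `δ z`. -/
def Solvable (ℓ ℓ' : J → Fin N) (Z : Fin N → Type)
    (W : (∀ x, Z x) → Matrix.unitaryGroup (Bits J) ℂ) (δ : (∀ x, Z x) → ℝ) : Prop :=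
  ∃ (A : Protocol ℓ ℓ' Z) (c : (∀ x, Z x) → (∀ x, A.K x) → ℂ),
    (∀ z k, c z k = 0 ∨ ∃ V ∈ localUnitaries J, A.eff z k = c z k • ((V * W z :
      Matrix.unitaryGroup (Bits J) ℂ) : Matrix (Bits J) (Bits J) ℂ)) ∧
    ∀ z, 1 - δ z ≤ ∑ k, ‖c z k‖ ^ 2

theorem Solvable.mono {ℓ ℓ' : J → Fin N} {Z : Fin N → Type}
    {W : (∀ x, Z x) → Matrix.unitaryGroup (Bits J) ℂ} {δ δ' : (∀ x, Z x) → ℝ}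
    (h : Solvable ℓ ℓ' Z W δ) (hδ : ∀ z, δ z ≤ δ' z) : Solvable ℓ ℓ' Z W δ' := by
  obtain ⟨A, c, h, hc⟩ := h
  exact ⟨A, c, h, fun z => (sub_le_sub_left (hδ z) 1).trans (hc z)⟩

/-- The protocol that does nothing. -/
def Protocol.idle (ℓ : J → Fin N) (Z : Fin N → Type) : Protocol ℓ ℓ Z where
  R _ := Unit
  state _ := 1
  isLinkState := isLinkState_one
  K _ := Unit
  op x _ := .ofEntries (fun _ t s => if t = s.1 then 1 else 0) (by
    rintro ⟨s, _⟩ ⟨s', _⟩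
    simp [Prod.ext_iff, eq_comm])

theorem Protocol.idle_eff (ℓ : J → Fin N) (Z : Fin N → Type) (z : ∀ x, Z x) (k) :
    (Protocol.idle ℓ Z).eff z k = 1 := by
  ext t s
  change ∑ _ : Fin N → Unit, (1 : ℂ) *
    ∏ x, (if localPart ℓ t x = localPart ℓ s x then (1 : ℂ) else 0) = _
  have h : localPart ℓ t = localPart ℓ s ↔ t = s := (splitEquiv (Fin 2) ℓ).apply_eq_iff_eq
  simp only [Fintype.prod_boole, ← funext_iff, h, Matrix.one_apply]
  simp

open Classical in
-- Doing nothing is correct up to one-qubit unitaries exactly when the task is local. This starts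
-- the recursion over the rounds, with error bound `1`.
theorem solvable_idle (ℓ : J → Fin N) (Z : Fin N → Type)
    (W : (∀ x, Z x) → Matrix.unitaryGroup (Bits J) ℂ) :
    Solvable ℓ ℓ Z W fun z => if W z ∈ localUnitaries J then 0 else 1 := by
  refine ⟨Protocol.idle ℓ Z, fun z _ => if W z ∈ localUnitaries J then 1 else 0, fun z k => ?_,
    fun z => ?_⟩
  · beta_reduce
    split_ifs with h
    · refine Or.inr ⟨(W z)⁻¹, inv_mem h, ?_⟩
      simp [Protocol.idle_eff]
    · exact Or.inl rfl
  · have : Unique (∀ x, (Protocol.idle ℓ Z).K x) := (inferInstance : Unique (Fin N → Unit))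
    beta_reduce
    split_ifs <;> simp

end Protocols

/-- Families of pairs are pairs of families. -/
def piProdEquiv {X : Type*} (F G : X → Type*) : (∀ x, F x × G x) ≃ (∀ x, F x) × ∀ x, G x where
  toFun q := (fun x => (q x).1, fun x => (q x).2)
  invFun q x := (q.1 x, q.2 x)
  left_inv _ := rfl
  right_inv _ := rfl

theorem sum_pi_prod {X M : Type*} [AddCommMonoid M] [Fintype X] [DecidableEq X] {F G : X → Type*}
    [∀ x, Fintype (F x)] [∀ x, Fintype (G x)] (f : (∀ x, F x × G x) → M) :
    ∑ q, f q = ∑ a : ∀ x, F x, ∑ b : ∀ x, G x, f fun x => (a x, b x) := by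
  rw [Fintype.sum_equiv (piProdEquiv F G) f fun q => f ((piProdEquiv F G).symm q)]
  · exact Fintype.sum_prod_type _
  · exact fun _ => rfl

theorem prod_sum_localPart {N : ℕ} {J α M : Type*} [Fintype J] [DecidableEq J] [Fintype α]
    [CommSemiring M] (ℓ : J → Fin N) (f : ∀ x, ({j // ℓ j = x} → α) → M) :
    ∏ x, ∑ u, f x u = ∑ u : J → α, ∏ x, f x (localPart ℓ u x) := by
  rw [Fintype.prod_sum]
  exact (Fintype.sum_equiv (splitEquiv α ℓ) _ _ fun _ => rfl).symm

/-! ### Composition with local unitaries and with teleportation -/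

section CompleteFamilies

/-- Completeness in polarized form: it gives the completeness of an operation that is preceded by
another one. -/
theorem QuantumOperation.sum_star_sum_mul_sum {K ι κ : Type*} [Fintype K] [Fintype ι]
    [DecidableEq ι] [Fintype κ] (A : QuantumOperation K ι κ) (f g : ι → ℂ) :
    ∑ k, ∑ a, star (∑ i, A.kraus k a i * f i) * ∑ j, A.kraus k a j * g j =
      ∑ i, star (f i) * g i := by
  calc ∑ k, ∑ a, star (∑ i, A.kraus k a i * f i) * ∑ j, A.kraus k a j * g j
      = ∑ j, ∑ i, (∑ k, ∑ a, star (A.kraus k a i) * A.kraus k a j) * (star (f i) * g j) := by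
        simp only [star_sum, Finset.sum_mul, Finset.mul_sum]
        rw [Finset.sum_congr rfl fun k _ => Finset.sum_comm, Finset.sum_comm]
        refine Finset.sum_congr rfl fun i _ => ?_
        rw [Finset.sum_congr rfl fun k _ => Finset.sum_comm, Finset.sum_comm]
        refine Finset.sum_congr rfl fun j _ => Finset.sum_congr rfl fun k _ =>
          Finset.sum_congr rfl fun a _ => ?_
        rw [star_mul']
        ring
    _ = _ := by
        simp only [A.sum_star_mul, ite_mul, one_mul, zero_mul, Finset.sum_ite_eq',
          Finset.mem_univ, if_true]

theorem sum_star_sum_bell_mul {J : Type*} [Fintype J] [DecidableEq J] (f g : Bits J → ℂ)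
    (w w' : Bits J) :
    ∑ b : J → Fin 2 × Fin 2, star (∑ o, bell b o w * f o) * ∑ o, bell b o w' * g o =
      if w = w' then ∑ o, star (f o) * g o else 0 := by
  calc ∑ b : J → Fin 2 × Fin 2, star (∑ o, bell b o w * f o) * ∑ o, bell b o w' * g o
      = ∑ o', ∑ o, (∑ b : J → Fin 2 × Fin 2, star (bell b o w) * bell b o' w') *
          (star (f o) * g o') := by
        simp only [star_sum, Finset.sum_mul, Finset.mul_sum]
        rw [Finset.sum_comm]
        refine Finset.sum_congr rfl fun i _ => ?_
        rw [Finset.sum_comm]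
        refine Finset.sum_congr rfl fun j _ => Finset.sum_congr rfl fun k _ => ?_
        rw [star_mul']
        ring
    _ = _ := by
        simp only [sum_star_bell_mul, ite_and]
        split_ifs with h <;> simp

end CompleteFamilies

section Constructions
variable {N : ℕ} {J : Type} [Fintype J] [DecidableEq J] {ℓ ℓ' ℓ'' : J → Fin N} {Z : Fin N → Type}

/-- The protocol `A` after local unitaries. -/
def Protocol.precomp (A : Protocol ℓ ℓ' Z)
    (G : ∀ x, Matrix.unitaryGroup (Bits {j // ℓ j = x}) ℂ) : Protocol ℓ ℓ' Z where
  R := A.R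
  state := A.state
  isLinkState := A.isLinkState
  K := A.K
  op x z := .ofEntries (fun k t q => ∑ i, (A.op x z).kraus k t i *
      if i.2 = q.2 then (G x : Matrix _ _ ℂ) i.1 q.1 else 0) (by
    rintro ⟨s, r⟩ ⟨s', r'⟩
    rw [QuantumOperation.sum_star_sum_mul_sum, Fintype.sum_prod_type]
    have h := congrFun (congrFun (Matrix.mem_unitaryGroup_iff'.1 (G x).2) s) s'
    rw [Matrix.mul_apply, Matrix.one_apply] at h
    by_cases hr : r = r'
    · simpa [hr, Matrix.star_apply] using h
    · simp [hr, Ne.symm hr])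

theorem Protocol.precomp_eff (A : Protocol ℓ ℓ' Z)
    (G : ∀ x, Matrix.unitaryGroup (Bits {j // ℓ j = x}) ℂ) (z : ∀ x, Z x) (k : ∀ x, A.K x) :
    (A.precomp G).eff z k = A.eff z k *
      Matrix.of fun u s => ∏ x, (G x : Matrix _ _ ℂ) (localPart ℓ u x) (localPart ℓ s x) := by
  ext t s
  change ∑ r, A.state r * ∏ x, ∑ i, (A.op x (z x)).kraus (k x) (localPart ℓ' t x) i *
      (if i.2 = r x then (G x : Matrix _ _ ℂ) i.1 (localPart ℓ s x) else 0) = _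
  simp only [Fintype.sum_prod_type, mul_ite, mul_zero, Finset.sum_ite_eq', Finset.mem_univ, if_true,
    prod_sum_localPart, Finset.prod_mul_distrib, Matrix.mul_apply, Protocol.eff, Finset.mul_sum,
    Finset.sum_mul, Matrix.of_apply]
  rw [Finset.sum_comm]
  simp only [mul_assoc]

/-- With all qubits at `p`, the other parties have one-dimensional registers, so `G` at `p` and
identities elsewhere multiply to `G`. -/
theorem exists_localize_unitary (p : Fin N) (G : Matrix.unitaryGroup (Bits J) ℂ) :
    ∃ G' : ∀ x, Matrix.unitaryGroup (Bits {_j : J // p = x}) ℂ, ∀ u s,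
      ∏ x, (G' x : Matrix _ _ ℂ) (localPart (fun _ => p) u x) (localPart (fun _ => p) s x) =
        G.1 u s := by
  have key : ∀ x, p = x → ∃ G' : Matrix.unitaryGroup (Bits {_j : J // p = x}) ℂ, ∀ u s : Bits J,
      (G' : Matrix _ _ ℂ) (localPart (fun _ => p) u x) (localPart (fun _ => p) s x) =
        G.1 u s := by
    rintro x rfl
    let e : Bits {_j : J // p = p} ≃ Bits J :=
      Equiv.arrowCongr (Equiv.subtypeUnivEquiv fun _ => rfl) (Equiv.refl _)
    exact ⟨reindexUnitary e.symm G, fun _ _ => rfl⟩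
  choose! G' hG' using key
  classical
  refine ⟨fun x => if p = x then G' x else 1, fun u s => ?_⟩
  rw [Finset.prod_eq_single p]
  · simpa using hG' p rfl u s
  · intro x _ hx
    have : IsEmpty {_j : J // p = x} := ⟨fun j => hx j.2.symm⟩
    rw [Subsingleton.elim (localPart (fun _ => p) u x) (localPart _ s x)]
    simp [hx.symm]
  · simp

/-- The holder of all qubits applies `G` first. `G` must be the same for all inputs, and
`Solvable.select` is what makes this enough. -/
theorem Solvable.precomp {p : Fin N} {W : (∀ x, Z x) → Matrix.unitaryGroup (Bits J) ℂ}
    {δ : (∀ x, Z x) → ℝ} (G : Matrix.unitaryGroup (Bits J) ℂ)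
    (h : Solvable (fun _ => p) ℓ' Z (fun z => W z * G⁻¹) δ) :
    Solvable (fun _ => p) ℓ' Z W δ := by
  obtain ⟨A, c, h, hc⟩ := h
  obtain ⟨G', hG'⟩ := exists_localize_unitary p G
  refine ⟨A.precomp G', c, fun z k => (h z k).imp_right ?_, hc⟩
  rintro ⟨V, hV, e⟩
  refine ⟨V, hV, (A.precomp_eff G' z k).trans ?_⟩
  have : (Matrix.of fun u s => ∏ x, (G' x : Matrix _ _ ℂ) (localPart (fun _ => p) u x)
      (localPart (fun _ => p) s x)) = (G : Matrix (Bits J) (Bits J) ℂ) := by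
    ext u s
    exact hG' u s
  rw [this, e, Matrix.smul_mul, ← Submonoid.coe_mul]
  congr 2
  group

/-- A tensor product of Pauli operators. -/
def pauliString (a : J → Fin 2 × Fin 2) : Matrix.unitaryGroup (Bits J) ℂ :=
  tensorUnitary fun j => pauli (a j)

theorem pauliString_mem (a : J → Fin 2 × Fin 2) : pauliString a ∈ localUnitaries J :=
  ⟨_, rfl⟩

theorem pauliString_zero : pauliString (0 : J → Fin 2 × Fin 2) = 1 := by
  have : (fun j : J => pauli ((0 : J → Fin 2 × Fin 2) j)) = 1 := funext fun _ => pauli_zero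
  rw [pauliString, this, map_one]

theorem prod_bell_localPart {J : Type} [Fintype J] (ℓ : J → Fin N) (a : J → Fin 2 × Fin 2) (s u : Bits J) :
    ∏ x, bell (localPart ℓ a x) (localPart ℓ s x) (localPart ℓ u x) = bell a s u :=
  prod_localPart ℓ fun j => ((1 / Real.sqrt 2 : ℝ) : ℂ) * pauliMatrix (a j) (u j) (s j)

/-- The classical information gained by teleporting the qubits at `ℓ`. -/
abbrev BellOutcome (ℓ : J → Fin N) (x : Fin N) : Type := {j // ℓ j = x} → Fin 2 × Fin 2

/-- Teleport the qubits from `ℓ` to `ℓ'`, then execute `A` there. The outcomes of the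
teleportation are inputs of `A`. -/
noncomputable def Protocol.teleIn (A : Protocol ℓ' ℓ'' fun x => Z x × BellOutcome ℓ x) :
    Protocol ℓ ℓ'' Z where
  R x := (Bits {j // ℓ j = x} × Bits {j // ℓ' j = x}) × A.R x
  state r := linkState ℓ ℓ' (fun x => (r x).1) * A.state fun x => (r x).2
  isLinkState := (isLinkState_linkState ℓ ℓ').mul A.isLinkState
  K x := BellOutcome ℓ x × A.K x
  op x z := .ofEntries (fun k t q => bell k.1 q.1 q.2.1.1 *
      (A.op x (z, k.1)).kraus k.2 t (q.2.1.2, q.2.2)) (by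
    rintro ⟨s, ⟨u, v⟩, r⟩ ⟨s', ⟨u', v'⟩, r'⟩
    rw [Fintype.sum_prod_type]
    have e : ∀ (a : BellOutcome ℓ x) k t, star (bell a s u * (A.op x (z, a)).kraus k t (v, r)) *
        (bell a s' u' * (A.op x (z, a)).kraus k t (v', r')) = (star (bell a s u) * bell a s' u') *
        (star ((A.op x (z, a)).kraus k t (v, r)) * (A.op x (z, a)).kraus k t (v', r')) := by
      intro a k t
      rw [star_mul']
      ring
    simp only [e, ← Finset.mul_sum, QuantumOperation.sum_star_mul, ← Finset.sum_mul,
      sum_star_bell_mul]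
    simp only [Prod.mk.injEq, ← ite_and, mul_ite, mul_one, mul_zero]
    congr 1
    exact propext (by tauto))

/-- Summing over the EPR bits contracts every Bell amplitude with a pair, and `sum_bell_mul_eprPair`
turns this into a Pauli operator and a factor `1 / 2` per qubit. -/
theorem Protocol.teleIn_eff (A : Protocol ℓ' ℓ'' fun x => Z x × BellOutcome ℓ x) (z : ∀ x, Z x)
    (a : J → Fin 2 × Fin 2) (k : ∀ x, A.K x) :
    A.teleIn.eff z (fun x => (localPart ℓ a x, k x)) = ((1 / 2 : ℂ) ^ Fintype.card J) •
      (A.eff (fun x => (z x, localPart ℓ a x)) k * (pauliString a : Matrix _ _ ℂ)) := by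
  ext t s
  change ∑ r : ∀ x, (Bits {j // ℓ j = x} × Bits {j // ℓ' j = x}) × A.R x,
    (linkState ℓ ℓ' (fun x => (r x).1) * A.state fun x => (r x).2) *
    ∏ x, (bell (localPart ℓ a x) (localPart ℓ s x) (r x).1.1 * (A.op x (z x, localPart ℓ a x)).kraus
      (k x) (localPart ℓ'' t x) ((r x).1.2, (r x).2)) = _
  rw [sum_pi_prod, sum_pi_prod, ← Fintype.sum_equiv (splitEquiv (Fin 2) ℓ) _ _ fun _ => rfl]
  simp only [← Fintype.sum_equiv (splitEquiv (Fin 2) ℓ') _ _ fun _ => rfl]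
  have e : ∀ u v : Bits J, linkState ℓ ℓ' (fun x => (splitEquiv _ ℓ u x, splitEquiv _ ℓ' v x)) =
      ∏ j, eprPair (u j) (v j) := fun _ _ => rfl
  simp only [e, Finset.prod_mul_distrib]
  have e' : ∀ u : Bits J, ∏ x, bell (localPart ℓ a x) (localPart ℓ s x) (splitEquiv _ ℓ u x) =
      bell a s u := prod_bell_localPart ℓ a s
  simp only [e', Matrix.smul_apply, Matrix.mul_apply, smul_eq_mul, Finset.mul_sum]
  have e'' : ∀ v : Bits J, (1 / 2 : ℂ) ^ Fintype.card J * (pauliString a : Matrix _ _ ℂ) v s =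
      ∑ u : Bits J, bell a s u * ∏ j, eprPair (u j) (v j) :=
    fun v => (sum_bell_mul_eprPair a s v).symm
  rw [Finset.sum_comm]
  refine Finset.sum_congr rfl fun v _ => ?_
  rw [mul_left_comm, e'', Finset.mul_sum]
  refine Finset.sum_congr rfl fun u _ => ?_
  simp only [Protocol.eff, Finset.sum_mul]
  refine Finset.sum_congr rfl fun r _ => ?_
  change _ * (_ * ∏ x, (A.op x (z x, localPart ℓ a x)).kraus (k x) (localPart ℓ'' t x)
    (localPart ℓ' v x, r x)) = _
  ring

theorem norm_half_pow_sq (d : ℕ) : ‖(1 / 2 : ℂ) ^ d‖ ^ 2 = (1 / 4) ^ d := by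
  rw [norm_pow, ← pow_mul, mul_comm, pow_mul]
  norm_num

/-- The protocol that follows has to undo the Pauli error before `W`. All Bell outcomes are equally
likely, hence the new error is the average of the old ones. -/
theorem Solvable.teleIn {W : (∀ x, Z x) → Matrix.unitaryGroup (Bits J) ℂ}
    {δ : (∀ x, Z x × BellOutcome ℓ x) → ℝ}
    (h : Solvable ℓ' ℓ'' (fun x => Z x × BellOutcome ℓ x) (fun y => W (fun x => (y x).1) *
      (pauliString ((splitEquiv _ ℓ).symm fun x => (y x).2))⁻¹) δ) :
    Solvable ℓ ℓ'' Z W fun z => (1 / 4) ^ Fintype.card J *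
      ∑ a : J → Fin 2 × Fin 2, δ fun x => (z x, localPart ℓ a x) := by
  obtain ⟨A, c, h, hc⟩ := h
  refine ⟨A.teleIn, fun z (k : ∀ x, BellOutcome ℓ x × A.K x) => (1 / 2 : ℂ) ^ Fintype.card J *
    c (fun x => (z x, (k x).1)) (fun x => (k x).2), fun z k => ?_, fun z => ?_⟩
  · obtain ⟨⟨a, k⟩, rfl⟩ := (piProdEquiv (BellOutcome ℓ) A.K).symm.surjective k
    obtain ⟨a, rfl⟩ := (splitEquiv _ ℓ).surjective a
    refine (h (fun x => (z x, localPart ℓ a x)) k).imp (fun e => ?_) ?_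
    · exact mul_eq_zero_of_right _ e
    · rintro ⟨V, hV, e⟩
      refine ⟨V, hV, (A.teleIn_eff z a k).trans ?_⟩
      rw [e, Matrix.smul_mul, ← Submonoid.coe_mul, smul_smul]
      change _ • ((V * (W z * (pauliString a)⁻¹) * pauliString a :
        Matrix.unitaryGroup (Bits J) ℂ) : Matrix (Bits J) (Bits J) ℂ) = _ • _
      rw [mul_assoc, inv_mul_cancel_right]
      rfl
  · calc 1 - (1 / 4) ^ Fintype.card J * ∑ a : J → Fin 2 × Fin 2, δ (fun x => (z x, localPart ℓ a x))
        = (1 / 4) ^ Fintype.card J *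
          ∑ a : J → Fin 2 × Fin 2, (1 - δ fun x => (z x, localPart ℓ a x)) := by
          rw [Finset.sum_sub_distrib, mul_sub]
          simp
      _ ≤ (1 / 4) ^ Fintype.card J * ∑ a : J → Fin 2 × Fin 2, ∑ k : ∀ x, A.K x,
          ‖c (fun x => (z x, localPart ℓ a x)) k‖ ^ 2 := by
          gcongr with a
          exact hc _
      _ = ∑ k : ∀ x, BellOutcome ℓ x × A.K x, ‖(1 / 2 : ℂ) ^ Fintype.card J *
          c (fun x => (z x, (k x).1)) (fun x => (k x).2)‖ ^ 2 := by
          rw [sum_pi_prod (F := BellOutcome ℓ),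
            ← Fintype.sum_equiv (splitEquiv _ ℓ) _ _ fun _ => rfl]
          simp only [norm_mul, mul_pow, ← Finset.mul_sum, norm_half_pow_sq]
          rfl

/-- Execute `A`, then teleport the qubits from `ℓ'` to `ℓ''`. -/
noncomputable def Protocol.teleOut (A : Protocol ℓ ℓ' Z) (ℓ'' : J → Fin N) : Protocol ℓ ℓ'' Z where
  R x := A.R x × (Bits {j // ℓ' j = x} × Bits {j // ℓ'' j = x})
  state r := A.state (fun x => (r x).1) * linkState ℓ' ℓ'' fun x => (r x).2
  isLinkState := A.isLinkState.mul (isLinkState_linkState ℓ' ℓ'')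
  K x := A.K x × BellOutcome ℓ' x
  op x z := .ofEntries (fun k t q => if t = q.2.2.2 then
      ∑ o, bell k.2 o q.2.2.1 * (A.op x z).kraus k.1 o (q.1, q.2.1) else 0) (by
    rintro ⟨s, r, w, y⟩ ⟨s', r', w', y'⟩
    rw [Fintype.sum_prod_type]
    by_cases hy : y = y'
    · subst hy
      have e : ∀ (k : A.K x) (b : BellOutcome ℓ' x), (∑ t : Bits {j // ℓ'' j = x},
          star (if t = y then ∑ o, bell b o w * (A.op x z).kraus k o (s, r) else 0) *
          (if t = y then ∑ o, bell b o w' * (A.op x z).kraus k o (s', r') else 0)) =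
          star (∑ o, bell b o w * (A.op x z).kraus k o (s, r)) *
            ∑ o, bell b o w' * (A.op x z).kraus k o (s', r') := by
        intro k b
        rw [Fintype.sum_eq_single y]
        · simp
        · intro t ht
          simp [ht]
      simp only [e, sum_star_sum_bell_mul]
      by_cases hw : w = w'
      · simp only [hw, if_true, QuantumOperation.sum_star_mul]
        simp
      · simp [hw]
    · rw [if_neg (by simp [hy])]
      refine Finset.sum_eq_zero fun k _ => Finset.sum_eq_zero fun b _ =>
        Finset.sum_eq_zero fun t _ => ?_
      by_cases ht : t = y
      · simp [ht, hy]
      · simp [ht])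

set_option maxHeartbeats 1000000 in
theorem Protocol.teleOut_eff (A : Protocol ℓ ℓ' Z) (z : ∀ x, Z x)
    (b : J → Fin 2 × Fin 2) (k : ∀ x, A.K x) :
    (A.teleOut ℓ'').eff z (fun x => (k x, localPart ℓ' b x)) = ((1 / 2 : ℂ) ^ Fintype.card J) •
      ((pauliString b : Matrix _ _ ℂ) * A.eff z k) := by
  ext t s
  change ∑ r : ∀ x, A.R x × (Bits {j // ℓ' j = x} × Bits {j // ℓ'' j = x}),
    (A.state (fun x => (r x).1) * linkState ℓ' ℓ'' fun x => (r x).2) *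
    ∏ x, (if localPart ℓ'' t x = (r x).2.2 then ∑ o, bell (localPart ℓ' b x) o (r x).2.1 *
      (A.op x (z x)).kraus (k x) o (localPart ℓ s x, (r x).1) else 0) = _
  rw [sum_pi_prod]
  simp only [sum_pi_prod, ← Fintype.sum_equiv (splitEquiv (Fin 2) ℓ') _ _ fun _ => rfl,
    ← Fintype.sum_equiv (splitEquiv (Fin 2) ℓ'') _ _ fun _ => rfl]
  have e : ∀ u v : Bits J, linkState ℓ' ℓ'' (fun x => (splitEquiv _ ℓ' u x, splitEquiv _ ℓ'' v x)) =
      ∏ j, eprPair (u j) (v j) := fun _ _ => rfl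
  have e' : ∀ o u : Bits J, ∏ x, bell (localPart ℓ' b x) (localPart ℓ' o x) (splitEquiv _ ℓ' u x) =
      bell b o u := prod_bell_localPart ℓ' b
  have e'' : ∀ o : Bits J, (1 / 2 : ℂ) ^ Fintype.card J * (pauliString b : Matrix _ _ ℂ) t o =
      ∑ w : Bits J, bell b o w * ∏ j, eprPair (w j) (t j) :=
    fun o => (sum_bell_mul_eprPair b o t).symm
  have e3 : ∀ (r : ∀ x, A.R x) (w y : Bits J), (∏ x, if localPart ℓ'' t x = splitEquiv _ ℓ'' y x
      then ∑ o, bell (localPart ℓ' b x) o (splitEquiv _ ℓ' w x) *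
      (A.op x (z x)).kraus (k x) o (localPart ℓ s x, r x) else 0) =
      if t = y then ∑ o, bell b o w * ∏ x, (A.op x (z x)).kraus (k x) (localPart ℓ' o x)
        (localPart ℓ s x, r x) else 0 := by
    intro r w y
    split_ifs with hy
    · subst hy
      have : ∀ x, localPart ℓ'' t x = splitEquiv _ ℓ'' t x := fun _ => rfl
      simp only [this, if_true, prod_sum_localPart, Finset.prod_mul_distrib, e']
    · have : localPart ℓ'' t ≠ splitEquiv _ ℓ'' y := fun h => hy ((splitEquiv _ ℓ'').injective h)
      obtain ⟨x, hx⟩ := Function.ne_iff.1 this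
      exact Finset.prod_eq_zero (Finset.mem_univ x) (if_neg hx)
  simp only [e, e3, mul_ite, mul_zero, Finset.sum_ite_eq, Finset.mem_univ, if_true,
    Matrix.smul_apply, Matrix.mul_apply, smul_eq_mul, Finset.mul_sum]
  simp only [← mul_assoc, e'', Finset.sum_mul, Protocol.eff, Finset.mul_sum]
  rw [Finset.sum_comm, Finset.sum_congr rfl fun w _ => Finset.sum_comm, Finset.sum_comm]
  refine Finset.sum_congr rfl fun o _ => ?_
  rw [Finset.sum_comm]
  refine Finset.sum_congr rfl fun r _ => Finset.sum_congr rfl fun w _ => ?_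
  ring

/-- The Pauli error appears to the left of `V` and is absorbed by it, so moving the qubits after the
computation costs nothing. -/
theorem Solvable.teleOut {W : (∀ x, Z x) → Matrix.unitaryGroup (Bits J) ℂ}
    {δ : (∀ x, Z x) → ℝ} (h : Solvable ℓ ℓ' Z W δ) (ℓ'' : J → Fin N) : Solvable ℓ ℓ'' Z W δ := by
  obtain ⟨A, c, h, hc⟩ := h
  refine ⟨A.teleOut ℓ'', fun z (k : ∀ x, A.K x × BellOutcome ℓ' x) =>
    (1 / 2 : ℂ) ^ Fintype.card J * c z (fun x => (k x).1), fun z k => ?_, fun z => ?_⟩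
  · obtain ⟨⟨k, b⟩, rfl⟩ := (piProdEquiv A.K (BellOutcome ℓ')).symm.surjective k
    obtain ⟨b, rfl⟩ := (splitEquiv _ ℓ').surjective b
    refine (h z k).imp (fun e => ?_) ?_
    · exact mul_eq_zero_of_right _ e
    · rintro ⟨V, hV, e⟩
      refine ⟨pauliString b * V, mul_mem (pauliString_mem b) hV, (A.teleOut_eff z b k).trans ?_⟩
      rw [e, Matrix.mul_smul, ← Submonoid.coe_mul, smul_smul, mul_assoc]
      rfl
  · refine (hc z).trans (le_of_eq ?_)
    change _ = ∑ k : ∀ x, A.K x × BellOutcome ℓ' x,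
      ‖(1 / 2 : ℂ) ^ Fintype.card J * c z (fun x => (k x).1)‖ ^ 2
    rw [sum_pi_prod]
    refine Finset.sum_congr rfl fun k _ => ?_
    rw [← Fintype.sum_equiv (splitEquiv _ ℓ') _ _ fun _ => rfl]
    simp only [norm_mul, mul_pow, norm_half_pow_sq, Finset.sum_const, Finset.card_univ,
      Fintype.card_pi, Fintype.card_prod, Fintype.card_fin, Finset.prod_const, nsmul_eq_mul]
    push_cast
    -- There are `4 ^ |J|` outcomes of probability `4 ^ (-|J|)` each.
    have e : (2 : ℝ) ^ Fintype.card J * 2 ^ Fintype.card J * (1 / 4) ^ Fintype.card J = 1 := by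
      rw [← mul_pow, ← mul_pow]
      norm_num
    rw [← mul_assoc, e, one_mul]

end Constructions

/-! ### Selecting one of several parallel protocols -/

section Select
variable {N : ℕ} {J : Type} [Fintype J] [DecidableEq J] {Z : Fin N → Type} {p : Fin N}

/-- The outputs of all copies are the output `t` of the selected copy together with the measured
outputs of the others. Requiring `d c = 0` fixes the meaningless entry of `d` at the selected copy,
so that each family is counted once. -/
theorem sum_update_eq_sum {C T M : Type*} [Fintype C] [DecidableEq C] [Fintype T] [DecidableEq T]
    [Zero T] [AddCommMonoid M] (c : C) (f : (C → T) → M) :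
    ∑ d : C → T, ∑ t, (if d c = 0 then f (Function.update d c t) else 0) = ∑ o, f o := by
  rw [← Fintype.sum_prod_type' fun d t => if d c = 0 then f (Function.update d c t) else 0,
    ← Finset.sum_filter]
  refine Finset.sum_nbij' (fun q => Function.update q.1 c q.2)
    (fun o => (Function.update o c 0, o c)) ?_ ?_ ?_ ?_ ?_
  · simp
  · simp
  · rintro ⟨d, t⟩ h
    have h : d c = 0 := by simpa using h
    simp [← h]
  · simp
  · simp

/-- Execute the protocol `A c` on the qubits, where `c` is selected by party `p`, and all other
protocols on `|0⟩`. -/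
noncomputable def Protocol.select {C : Type} [Fintype C] [DecidableEq C]
    (A : C → Protocol (fun _ : J => p) (fun _ => p) Z) (sel : ∀ x, Z x → C) :
    Protocol (fun _ : J => p) (fun _ => p) Z where
  R x := ∀ c, (A c).R x
  state r := ∏ c, (A c).state fun x => r x c
  isLinkState := IsLinkState.pi fun c => (A c).isLinkState
  K x := (∀ c, (A c).K x) × (C → Bits {_j : J // p = x})
  op x z := .ofEntries (fun k t q => if k.2 (sel x z) = 0 then
      ∏ c, ((A c).op x z).kraus (k.1 c) (Function.update k.2 (sel x z) t c)
        (Function.update (0 : C → Bits {_j : J // p = x}) (sel x z) q.1 c, q.2 c) else 0) (by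
    rintro ⟨s, r⟩ ⟨s', r'⟩
    let H : C → Bits {_j : J // p = x} → ℂ := fun c o => ∑ k,
      star (((A c).op x z).kraus k o
        (Function.update (0 : C → Bits {_j : J // p = x}) (sel x z) s c, r c)) *
      ((A c).op x z).kraus k o
        (Function.update (0 : C → Bits {_j : J // p = x}) (sel x z) s' c, r' c)
    trans ∑ d : C → Bits {_j : J // p = x}, ∑ t,
      if d (sel x z) = 0 then ∏ c, H c (Function.update d (sel x z) t c) else 0
    · rw [Fintype.sum_prod_type, Finset.sum_comm]
      refine Finset.sum_congr rfl fun d _ => ?_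
      rw [Finset.sum_comm]
      refine Finset.sum_congr rfl fun t _ => ?_
      split_ifs with h
      · simp only [H, Fintype.prod_sum, star_prod, ← Finset.prod_mul_distrib]
      · simp
    rw [sum_update_eq_sum (sel x z) fun o => ∏ c, H c (o c), ← Fintype.prod_sum fun c o => H c o]
    simp only [H]
    rw [Finset.prod_congr rfl fun c _ => Finset.sum_comm]
    simp only [QuantumOperation.sum_star_mul, Fintype.prod_boole, Prod.mk.injEq, forall_and,
      ← funext_iff]
    congr 1
    refine propext (and_congr_left fun _ => ?_)
    exact (Function.update_injective _ _).eq_iff)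

/-- Families of outcomes of several protocols and of measurements at `p`, protocol by protocol. -/
def splitOutcomes {C : Type} (K : C → Fin N → Type) (p : Fin N) :
    (∀ x, (∀ c, K c x) × (C → Bits {_j : J // p = x})) ≃ ∀ c, (∀ x, K c x) × Bits J where
  toFun k c := (fun x => (k x).1 c, fun j => (k p).2 c ⟨j, rfl⟩)
  invFun q x := (fun c => (q c).1 x, fun c => localPart (fun _ => p) (q c).2 x)
  left_inv k := by
    funext x
    refine Prod.ext rfl (funext fun c => funext fun j => ?_)
    obtain ⟨j, rfl⟩ := j
    rfl
  right_inv _ := rfl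

/-- The outcomes of `Protocol.select`, protocol by protocol. -/
def Protocol.selectEquiv {C : Type} [Fintype C] [DecidableEq C]
    (A : C → Protocol (fun _ : J => p) (fun _ => p) Z) (sel : ∀ x, Z x → C) :
    (∀ x, (Protocol.select A sel).K x) ≃ ∀ c, (∀ x, (A c).K x) × Bits J :=
  splitOutcomes (fun c => (A c).K) p

/-- Only the register of `p` is nontrivial, so the selection of `p` decides for all. The parties
other than `p` execute their share of every copy, and the joint operator factorizes over the copies.
-/
theorem Protocol.select_eff {C : Type} [Fintype C] [DecidableEq C]
    (A : C → Protocol (fun _ : J => p) (fun _ => p) Z) (sel : ∀ x, Z x → C) (z : ∀ x, Z x)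
    {c₀ : C} (h₀ : sel p (z p) = c₀) (q : ∀ c, (∀ x, (A c).K x) × Bits J) (t s : Bits J) :
    (Protocol.select A sel).eff z ((Protocol.selectEquiv A sel).symm q) t s =
      if (q c₀).2 = 0 then ∏ c, (A c).eff z (q c).1
        (Function.update (fun c => (q c).2) c₀ t c)
        (Function.update (0 : C → Bits J) c₀ s c) else 0 := by
  subst h₀
  have hS : ∀ x, x ≠ p → IsEmpty {_j : J // p = x} := fun x hx => ⟨fun j => hx j.2.symm⟩
  let k := (splitOutcomes (fun c => (A c).K) p).symm q
  change ∑ r : ∀ x, ∀ c, (A c).R x, (∏ c, (A c).state fun x => r x c) *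
    ∏ x, (if (k x).2 (sel x (z x)) = 0 then
      ∏ c, ((A c).op x (z x)).kraus ((k x).1 c)
        (Function.update (k x).2 (sel x (z x)) (localPart (fun _ => p) t x) c)
        (Function.update (0 : C → Bits {_j : J // p = x}) (sel x (z x)) (localPart (fun _ => p) s x) c, r x c) else 0) = _
  have e : ∀ (r : ∀ x, ∀ c, (A c).R x) x, (if (k x).2 (sel x (z x)) = 0 then
      ∏ c, ((A c).op x (z x)).kraus ((k x).1 c)
        (Function.update (k x).2 (sel x (z x)) (localPart (fun _ => p) t x) c)
        (Function.update (0 : C → Bits {_j : J // p = x}) (sel x (z x)) (localPart (fun _ => p) s x) c, r x c) else 0) =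
      (if x = p → (q (sel p (z p))).2 = 0 then 1 else 0) *
      ∏ c, ((A c).op x (z x)).kraus ((q c).1 x)
        (localPart (fun _ => p) (Function.update (fun c => (q c).2) (sel p (z p)) t c) x)
        (localPart (fun _ => p) (Function.update (0 : C → Bits J) (sel p (z p)) s c) x, r x c) := by
    intro r x
    by_cases hx : x = p
    · subst hx
      have h0 : (k x).2 (sel x (z x)) = 0 ↔ (q (sel x (z x))).2 = 0 :=
        ⟨fun h => funext fun j => congrFun h ⟨j, rfl⟩, fun h => funext fun j => congrFun h j.1⟩
      simp only [h0, forall_const, ite_mul, one_mul, zero_mul]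
      congr 1
      refine Finset.prod_congr rfl fun c _ => ?_
      by_cases hc : c = sel x (z x)
      · subst hc
        simp only [Function.update_self]
        rfl
      · simp only [Function.update_of_ne hc]
        rfl
    · have := hS x hx
      rw [if_pos (Subsingleton.elim _ _), if_pos (fun h => (hx h).elim), one_mul]
      refine Finset.prod_congr rfl fun c _ => ?_
      congr 1
      · exact Subsingleton.elim _ _
      · exact congrArg (·, r x c) (Subsingleton.elim _ _)
  simp only [e, Finset.prod_mul_distrib, Fintype.prod_boole, forall_eq]
  split_ifs with h
  · simp only [one_mul]
    rw [Finset.sum_congr rfl fun r _ => congrArg _ Finset.prod_comm]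
    simp only [← Finset.prod_mul_distrib, Protocol.eff]
    rw [Fintype.prod_sum]
    exact Fintype.sum_equiv (Equiv.piComm _) _ _ fun r => rfl
  · simp

/-- Party `p` feeds the qubits into the copy made for its actual input `c = z p`, so each copy may
treat this input as a constant. -/
theorem Solvable.select [∀ x, Fintype (Z x)] {W : (∀ x, Z x) → Matrix.unitaryGroup (Bits J) ℂ}
    {δ : Z p → (∀ x, Z x) → ℝ}
    (h : ∀ c : Z p, Solvable (fun _ => p) (fun _ => p) Z (fun z => W (Function.update z p c)) (δ c)) :
    Solvable (fun _ => p) (fun _ => p) Z W fun z => δ (z p) z := by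
  classical
  by_cases hZ : Nonempty (Z p)
  swap
  · exact (solvable_idle _ _ _).mono fun z => (hZ ⟨z p⟩).elim
  obtain ⟨sel, hsel⟩ : ∃ sel : ∀ x, Z x → Z p, sel p = id :=
    -- Away from `p` the choice acts on empty registers, so any value will do.
    ⟨fun x => if h : x = p then fun z => h ▸ z else fun _ => hZ.some, by simp; rfl⟩
  choose A w h hw using h
  let f : (∀ x, Z x) → (∀ c, (∀ x, (A c).K x) × Bits J) → ℂ := fun z q =>
    (if (q (z p)).2 = 0 then ∏ c ∈ Finset.univ.erase (z p), (A c).eff z (q c).1 (q c).2 0 else 0) *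
      w (z p) z (q (z p)).1
  refine ⟨Protocol.select A sel, fun z k => f z (Protocol.selectEquiv A sel k),
    fun z k => ?_, fun z => ?_⟩
  · obtain ⟨q, rfl⟩ := (Protocol.selectEquiv A sel).symm.surjective k
    beta_reduce
    rw [Equiv.apply_symm_apply]
    refine (h (z p) z (q (z p)).1).imp (fun e => ?_) ?_
    · exact mul_eq_zero_of_right _ e
    · rintro ⟨V, hV, e⟩
      refine ⟨V, hV, ?_⟩
      simp only [Function.update_eq_self] at e
      ext t s
      have e' := congrFun (congrFun e t) s
      rw [Matrix.smul_apply, smul_eq_mul] at e' ⊢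
      refine (Protocol.select_eff A sel z (congrFun hsel (z p)) q t s).trans ?_
      simp only [id]
      rw [← Finset.mul_prod_erase _ _ (Finset.mem_univ (z p))]
      simp only [Function.update_self, e', f]
      rw [Finset.prod_congr rfl fun c hc => by
        rw [Function.update_of_ne (Finset.ne_of_mem_erase hc),
          Function.update_of_ne (Finset.ne_of_mem_erase hc)]]
      split_ifs
      · simp only [Pi.zero_apply]
        ring
      · simp
  -- The squared weights factorize over the copies, and each copy that is not selected contributes
  -- its total probability `1`.
  · have key : ∑ q, ‖f z q‖ ^ 2 = ∑ k, ‖w (z p) z k‖ ^ 2 := by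
      let g : ∀ c, (∀ x, (A c).K x) × Bits J → ℝ := fun c q =>
        if c = z p then (if q.2 = 0 then ‖w c z q.1‖ ^ 2 else 0) else ‖(A c).eff z q.1 q.2 0‖ ^ 2
      have e : ∀ q, ‖f z q‖ ^ 2 = ∏ c, g c (q c) := by
        intro q
        rw [← Finset.mul_prod_erase _ _ (Finset.mem_univ (z p))]
        rw [Finset.prod_congr rfl fun c hc => if_neg (Finset.ne_of_mem_erase hc)]
        simp only [f, g, if_true]
        split_ifs
        · rw [norm_mul, mul_pow, norm_prod, Finset.prod_pow, mul_comm]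
        · simp
      simp only [e]
      rw [← Fintype.prod_sum, ← Finset.mul_prod_erase _ _ (Finset.mem_univ (z p)),
        Finset.prod_eq_one]
      · simp [g, Fintype.sum_prod_type]
      · intro c hc
        simp only [g, if_neg (Finset.ne_of_mem_erase hc), Fintype.sum_prod_type]
        exact (A c).sum_norm_sq_eff z 0
    refine (hw (z p) z).trans (le_of_eq ?_)
    rw [← key]
    exact (Fintype.sum_equiv (Protocol.selectEquiv A sel) _ _ fun _ => rfl).symm

end Select

/-! ### Rounds of teleportation that reduce the error -/

section Rounds
variable {N : ℕ} {J : Type} [Fintype J] [DecidableEq J]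

open Classical in
/-- Every computation on qubits held by a single party is solvable, except with probability at
most `δ`, and surely if it only requires one-qubit unitaries. -/
def SolvableUpTo (N : ℕ) (J : Type) [Fintype J] [DecidableEq J] (δ : ℝ) : Prop :=
  ∀ (p : Fin N) (Z : Fin N → Type) [∀ x, Fintype (Z x)]
    (W : (∀ x, Z x) → Matrix.unitaryGroup (Bits J) ℂ),
    Solvable (fun _ => p) (fun _ => p) Z W fun z => if W z ∈ localUnitaries J then 0 else δ

/-- A gain of `η` for the trivial outcome alone lowers the average over all `4 ^ d` outcomes by `η /
4 ^ d`. -/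
theorem average_le_sub {d : ℕ} (hd : Fintype.card J = d) {δ η : ℝ}
    {f : (J → Fin 2 × Fin 2) → ℝ} (h : ∀ a, f a ≤ δ) (h0 : f 0 ≤ δ - η) :
    (1 / 4) ^ d * ∑ a, f a ≤ δ - (1 / 4) ^ d * η := by
  have h4 : ((1 : ℝ) / 4) ^ d * 4 ^ d = 1 := by
    rw [← mul_pow]
    norm_num
  have hc : (Fintype.card (J → Fin 2 × Fin 2) : ℝ) = 4 ^ d := by
    simp only [Fintype.card_pi, Fintype.card_prod, Fintype.card_fin, Finset.prod_const,
      Finset.card_univ, hd]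
    norm_num
  calc (1 / 4) ^ d * ∑ a, f a
      ≤ (1 / 4) ^ d * ∑ a : J → Fin 2 × Fin 2, (δ - if a = 0 then η else 0) := by
        gcongr with a
        split_ifs with ha
        · exact ha ▸ h0
        · simpa using h a
    _ = δ - (1 / 4) ^ d * η := by
        rw [Finset.sum_sub_distrib, mul_sub, Finset.sum_const, Finset.card_univ, nsmul_eq_mul, hc,
          ← mul_assoc, h4, one_mul]
        simp

open Classical in
-- `T` consists of the parties still to be visited, starting with the holder `p`, and `t`
-- teleportations remain. `F` is the part of the task that only these parties' inputs determine, and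
-- `Q` collects the inverse Pauli errors. Since `Q` is local, the task is local if and only if `F`
-- is. A gain is claimed only for `Q = 1`, where the chance of `t` trivial outcomes is `4 ^ (-|J|
-- t)`.
theorem SolvableUpTo.round {δ : ℝ} (hδ : 0 ≤ δ) (hG : SolvableUpTo N J δ) (t : ℕ)
    (T : Finset (Fin N)) (hT : T.card = t + 1) (p : Fin N) (hp : p ∈ T) (Z : Fin N → Type)
    [∀ x, Fintype (Z x)] (F Q : (∀ x, Z x) → Matrix.unitaryGroup (Bits J) ℂ)
    (hF : ∀ z z', (∀ x ∈ T, z x = z' x) → F z = F z') (hQ : ∀ z, Q z ∈ localUnitaries J) :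
    Solvable (fun _ => p) (fun _ => p) Z (fun z => F z * Q z) fun z =>
      if F z ∈ localUnitaries J then 0 else
        if Q z = 1 then δ - ((1 / 4) ^ Fintype.card J) ^ t * δ else δ := by
  induction t generalizing T p Z with
  | zero =>
    by_cases hZ : Nonempty (∀ x, Z x)
    swap
    · exact (solvable_idle _ _ _).mono fun z => (hZ ⟨z⟩).elim
    obtain ⟨z₀⟩ := hZ
    obtain ⟨p', rfl⟩ := Finset.card_eq_one.1 hT
    obtain rfl := Finset.mem_singleton.1 hp
    refine (Solvable.select (δ := fun c z => if F (Function.update z p c) ∈ localUnitaries J then 0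
      else if Q (Function.update z p c) = 1 then 0 else δ) fun c => ?_).mono fun z => ?_
    -- The last holder knows `F`: with its own input fixed to `c`, all other inputs can be replaced
    -- by those of `z₀`. Applying `F` leaves the task `F * Q * F⁻¹` to `hG`; it is local if `F` is,
    -- and trivial if `Q = 1`.
    · refine Solvable.precomp (F (Function.update z₀ p c)) ((hG p Z _).mono fun z => ?_)
      have e : F (Function.update z₀ p c) = F (Function.update z p c) :=
        hF _ _ (by simp)
      rw [e]
      by_cases h1 : F (Function.update z p c) ∈ localUnitaries J
      · rw [if_pos h1, if_pos (mul_mem (mul_mem h1 (hQ _)) (inv_mem h1))]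
      · rw [if_neg h1]
        by_cases h2 : Q (Function.update z p c) = 1
        · simp [h2, one_mem]
        · rw [if_neg h2]
          split_ifs <;> simp [hδ]
    · simp
  | succ t ih =>
    obtain ⟨q, hq⟩ : (T.erase p).Nonempty := by
      rw [← Finset.card_pos, Finset.card_erase_of_mem hp]
      omega
    refine (Solvable.select (δ := fun c z => if F (Function.update z p c) ∈ localUnitaries J then 0
      else if Q (Function.update z p c) = 1 then δ - ((1 / 4) ^ Fintype.card J) ^ (t + 1) * δ
      else δ) fun c => ?_).mono fun z => ?_
    -- The qubits are sent on to `q`, the Bell outcomes of `p` enter `Q` only, and the qubits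
    -- finally return to `p`. As the input of `p` is fixed to `c`, `F` depends only on inputs of
    -- `T.erase p`.
    · have key := (ih (T.erase p) (by rw [Finset.card_erase_of_mem hp, hT]; rfl) q hq
        (fun x => Z x × BellOutcome (fun _ : J => p) x)
        (fun y => F (Function.update (fun x => (y x).1) p c))
        (fun y => Q (Function.update (fun x => (y x).1) p c) *
          (pauliString ((splitEquiv _ _).symm fun x => (y x).2))⁻¹) (fun y y' h => hF _ _ ?_)
        fun y => mul_mem (hQ _) (inv_mem (pauliString_mem _))).teleOut fun _ => p
      · simp only [← mul_assoc] at key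
        refine (Solvable.teleIn (W := fun z => F (Function.update z p c) *
          Q (Function.update z p c)) key).mono fun z => ?_
        have hη : (0 : ℝ) ≤ ((1 / 4) ^ Fintype.card J) ^ t * δ := by positivity
        have e : ∀ (a : J → Fin 2 × Fin 2),
          ((splitEquiv _ (fun _ => p)).symm fun x => localPart (fun _ => p) a x) = a := fun _ => rfl
        simp only [e]
        by_cases h1 : F (Function.update z p c) ∈ localUnitaries J
        · simp [h1]
        · simp only [h1, if_false]
          by_cases h2 : Q (Function.update z p c) = 1
          -- The trivial outcome keeps `Q = 1` and with it the gain of the remaining teleportations;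
          -- every other outcome has error at most `δ`.
          · rw [if_pos h2, pow_succ' _ t, mul_assoc]
            refine average_le_sub rfl (fun a => ?_) ?_
            · split_ifs <;> linarith
            · rw [if_pos (by simp [h2, pauliString_zero])]
          · rw [if_neg h2]
            refine (average_le_sub (δ := δ) (η := 0) rfl (fun a => ?_) ?_).trans (by simp)
            · split_ifs <;> linarith
            · split_ifs <;> linarith
      · intro x hx
        by_cases hxp : x = p
        · subst hxp
          simp
        · simp [hxp, h x (Finset.mem_erase.2 ⟨hxp, hx⟩)]
    · simp

/-- A full round visits all parties and starts without an error, that is, with `Q = 1`; it contains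
`N - 1` teleportations. -/
theorem SolvableUpTo.improve {δ : ℝ} (hδ : 0 ≤ δ) (hG : SolvableUpTo N J δ) :
    SolvableUpTo N J (δ - ((1 / 4) ^ Fintype.card J) ^ (N - 1) * δ) := by
  intro p Z _ W
  have hN : (Finset.univ : Finset (Fin N)).card = N - 1 + 1 := by
    have := p.pos
    simp
    omega
  have h := SolvableUpTo.round hδ hG (N - 1) Finset.univ hN p (Finset.mem_univ p) Z W
    (fun _ => 1) (fun z z' h => congrArg W (funext fun x => h x (Finset.mem_univ x)))
    fun _ => one_mem _
  simpa using h

theorem solvableUpTo_pow (N : ℕ) (J : Type) [Fintype J] [DecidableEq J] (r : ℕ) :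
    SolvableUpTo N J ((1 - ((1 / 4) ^ Fintype.card J) ^ (N - 1)) ^ r) := by
  induction r with
  | zero =>
    intro p Z _ W
    simpa using solvable_idle (fun _ => p) Z W
  | succ r ih =>
    have h : (((1 : ℝ) / 4) ^ Fintype.card J) ^ (N - 1) ≤ 1 :=
      pow_le_one₀ (by positivity) (pow_le_one₀ (by positivity) (by norm_num))
    have := ih.improve (pow_nonneg (sub_nonneg.2 h) r)
    rwa [← one_sub_mul, ← pow_succ'] at this

/-- All qubits are teleported to `p`, processed there with enough rounds, and teleported back. -/
theorem solvable_of_pos (p : Fin N) (ℓ : J → Fin N) (Z : Fin N → Type) [∀ x, Fintype (Z x)]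
    (W : (∀ x, Z x) → Matrix.unitaryGroup (Bits J) ℂ) {ε : ℝ} (hε : 0 < ε) :
    Solvable ℓ ℓ Z W fun _ => ε := by
  classical
  obtain ⟨r, hr⟩ := exists_pow_lt_of_lt_one hε
    (show (1 : ℝ) - ((1 / 4) ^ Fintype.card J) ^ (N - 1) < 1 by
      rw [sub_lt_self_iff]
      positivity)
  refine (Solvable.teleIn ((((solvableUpTo_pow N J r) p
    (fun x => Z x × BellOutcome ℓ x) _).mono (δ' := fun _ => ε) fun z => ?_).teleOut ℓ)).mono
    fun z => ?_
  · split_ifs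
    · exact hε.le
    · exact hr.le
  · simp

end Rounds

/-! ### Extracting the required EPR pairs from those shared by any two parties -/

section Extraction
variable {N m : ℕ} {I : Type} (f : I ↪ Fin m) (src tgt : I → Fin N)

/-- The half `w` of an EPR pair held by `x` is used for one of the links. -/
def HalfUsed (x : Fin N) (w : Halves N m x) : Prop :=
  ∃ i, f i = w.2 ∧ ((src i = x ∧ tgt i = w.1) ∨ (tgt i = x ∧ src i = w.1))

/-- The first half of the link `i` is taken from an EPR pair or, if both halves are at `x`,
prepared. -/
noncomputable def srcAmp (x : Fin N) (h : Bits (Halves N m x)) (i : {i // src i = x}) (b : Fin 2) :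
    ℂ :=
  if hi : tgt i = x then ((1 / Real.sqrt 2 : ℝ) : ℂ) else if b = h (⟨tgt i, hi⟩, f i) then 1 else 0

/-- The second half of the link `i` is taken from an EPR pair or, if both halves are at `x`,
prepared. -/
noncomputable def tgtAmp (x : Fin N) (h : Bits (Halves N m x)) (s : Bits {i // src i = x})
    (i : {i // tgt i = x}) (b : Fin 2) : ℂ :=
  if hi : src i = x then (if b = s ⟨i, hi⟩ then 1 else 0)
    else if b = h (⟨src i, hi⟩, f i) then 1 else 0

open Classical in
/-- Halves of EPR pairs that are not used are measured. -/
noncomputable def restAmp (x : Fin N) (h : Bits (Halves N m x)) (w : Halves N m x) (b : Fin 2) :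
    ℂ :=
  if HalfUsed f src tgt x w then (if b = 0 then 1 else 0) else if b = h w then 1 else 0

/-- Injectivity of `f` makes different links use different pairs, and a link with both ends at `x`
uses none, so the prescriptions for the bits never conflict. -/
theorem exists_half_bits (x : Fin N) (l : Bits (Halves N m x))
    (r : Bits {i // src i = x} × Bits {i // tgt i = x}) : ∃ h : Bits (Halves N m x),
    (∀ i hs hi, h (⟨tgt i, hi⟩, f i) = r.1 ⟨i, hs⟩) ∧
    (∀ i ht hi, h (⟨src i, hi⟩, f i) = r.2 ⟨i, ht⟩) ∧
    ∀ w, ¬ HalfUsed f src tgt x w → h w = l w := by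
  classical
  refine ⟨fun w => if hs : ∃ i, f i = w.2 ∧ src i = x ∧ tgt i = w.1 then
    r.1 ⟨hs.choose, hs.choose_spec.2.1⟩ else if ht : ∃ i, f i = w.2 ∧ tgt i = x ∧ src i = w.1 then
    r.2 ⟨ht.choose, ht.choose_spec.2.1⟩ else l w, fun i hs hi => ?_, fun i ht hi => ?_,
    fun w hw => ?_⟩
  · have h : ∃ i', f i' = f i ∧ src i' = x ∧ tgt i' = tgt i := ⟨i, rfl, hs, rfl⟩
    exact (dif_pos h).trans (congrArg r.1 (Subtype.ext (f.injective h.choose_spec.1)))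
  · have h : ∃ i', f i' = f i ∧ tgt i' = x ∧ src i' = src i := ⟨i, rfl, ht, rfl⟩
    have h' : ¬ ∃ i', f i' = f i ∧ src i' = x ∧ tgt i' = src i := by
      rintro ⟨i', e, e', -⟩
      exact hi (f.injective e ▸ e')
    exact (dif_neg h').trans ((dif_pos h).trans
      (congrArg r.2 (Subtype.ext (f.injective h.choose_spec.1))))
  · have h : ¬ ∃ i, f i = w.2 ∧ src i = x ∧ tgt i = w.1 :=
      fun ⟨i, e, e'⟩ => hw ⟨i, e, Or.inl e'⟩
    have h' : ¬ ∃ i, f i = w.2 ∧ tgt i = x ∧ src i = w.1 :=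
      fun ⟨i, e, e'⟩ => hw ⟨i, e, Or.inr e'⟩
    exact (dif_neg h).trans (dif_neg h')

theorem sum_srcAmp (x : Fin N) (h h' : Bits (Halves N m x)) (i : {i // src i = x}) :
    ∑ b, star (srcAmp f src tgt x h i b) * srcAmp f src tgt x h' i b =
      if ∀ hi : tgt i ≠ x, h (⟨tgt i, hi⟩, f i) = h' (⟨tgt i, hi⟩, f i) then 1 else 0 := by
  by_cases hi : tgt i = x
  · have : star ((1 / Real.sqrt 2 : ℝ) : ℂ) = ((1 / Real.sqrt 2 : ℝ) : ℂ) := Complex.conj_ofReal _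
    simp only [srcAmp, dif_pos hi, this, inv_sqrt_two_mul_self]
    simp [hi]
  · simp [srcAmp, hi, eq_comm]

theorem sum_tgtAmp (x : Fin N) (h h' : Bits (Halves N m x)) (s : Bits {i // src i = x})
    (i : {i // tgt i = x}) :
    ∑ b, star (tgtAmp f src tgt x h s i b) * tgtAmp f src tgt x h' s i b =
      if ∀ hi : src i ≠ x, h (⟨src i, hi⟩, f i) = h' (⟨src i, hi⟩, f i) then 1 else 0 := by
  by_cases hi : src i = x
  · simp [tgtAmp, hi]
  · simp [tgtAmp, hi, eq_comm]

open Classical in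
theorem sum_restAmp (x : Fin N) (h h' : Bits (Halves N m x)) (w : Halves N m x) :
    ∑ b, star (restAmp f src tgt x h w b) * restAmp f src tgt x h' w b =
      if ¬ HalfUsed f src tgt x w → h w = h' w then 1 else 0 := by
  by_cases hw : HalfUsed f src tgt x w
  · simp [restAmp, hw]
  · simp [restAmp, hw, eq_comm]

variable [Fintype I] [DecidableEq I]

/-- The local operation that extracts the halves of the links `I` from those of many EPR pairs. -/
noncomputable def extract (x : Fin N) : QuantumOperation (Bits (Halves N m x)) (Bits (Halves N m x))
    (Bits {i // src i = x} × Bits {i // tgt i = x}) :=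
  .ofEntries (fun l r h => (∏ i, srcAmp f src tgt x h i (r.1 i)) *
    (∏ i, tgtAmp f src tgt x h r.1 i (r.2 i)) * ∏ w, restAmp f src tgt x h w (l w)) (by
    classical
    intro h h'
    have e : ∀ (l : Bits (Halves N m x)) (s : Bits {i // src i = x}) (t : Bits {i // tgt i = x}),
      star ((∏ i, srcAmp f src tgt x h i (s i)) * (∏ i, tgtAmp f src tgt x h s i (t i)) *
        ∏ w, restAmp f src tgt x h w (l w)) * ((∏ i, srcAmp f src tgt x h' i (s i)) *
        (∏ i, tgtAmp f src tgt x h' s i (t i)) * ∏ w, restAmp f src tgt x h' w (l w)) =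
      (∏ w, star (restAmp f src tgt x h w (l w)) * restAmp f src tgt x h' w (l w)) *
      ((∏ i, star (srcAmp f src tgt x h i (s i)) * srcAmp f src tgt x h' i (s i)) *
      ∏ i, star (tgtAmp f src tgt x h s i (t i)) * tgtAmp f src tgt x h' s i (t i)) := by
      intro l s t
      simp only [star_mul', star_prod, Finset.prod_mul_distrib]
      ring
    simp only [Fintype.sum_prod_type, e, ← Finset.mul_sum, ← Finset.sum_mul]
    have e1 : ∀ s, (∑ t : Bits {i // tgt i = x}, ∏ i, star (tgtAmp f src tgt x h s i (t i)) *
        tgtAmp f src tgt x h' s i (t i)) = if ∀ (i : {i // tgt i = x}) (hi : src i ≠ x),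
          h (⟨src i, hi⟩, f i) = h' (⟨src i, hi⟩, f i) then 1 else 0 := by
      intro s
      rw [← Fintype.prod_sum fun i b => star (tgtAmp f src tgt x h s i b) *
        tgtAmp f src tgt x h' s i b]
      simp only [sum_tgtAmp, Fintype.prod_boole]
    simp only [e1, ← Finset.sum_mul]
    rw [← Fintype.prod_sum fun w b => star (restAmp f src tgt x h w b) *
        restAmp f src tgt x h' w b, ← Fintype.prod_sum fun i b => star (srcAmp f src tgt x h i b) *
        srcAmp f src tgt x h' i b]
    simp only [sum_srcAmp, sum_restAmp, Fintype.prod_boole, mul_ite, mul_one, mul_zero, ← ite_and]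
    congr 1
    refine propext ⟨fun ⟨⟨h1, h2⟩, h3⟩ => funext fun w => ?_, fun e => by simp [e]⟩
    by_cases hw : HalfUsed f src tgt x w
    · obtain ⟨⟨q, hq⟩, a⟩ := w
      obtain ⟨i, rfl, ⟨hs, rfl⟩ | ⟨ht, rfl⟩⟩ := hw
      · exact h2 ⟨i, hs⟩ hq
      · exact h1 ⟨i, ht⟩ hq
    · exact h3 w hw)

theorem extract_kraus (x : Fin N) (l : Bits (Halves N m x))
    (r : Bits {i // src i = x} × Bits {i // tgt i = x}) (h : Bits (Halves N m x)) :
    (extract f src tgt x).kraus l r h = (∏ i, srcAmp f src tgt x h i (r.1 i)) *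
      (∏ i, tgtAmp f src tgt x h r.1 i (r.2 i)) * ∏ w, restAmp f src tgt x h w (l w) := rfl

open Classical in
-- Output bits and measurement record together determine all bits of the halves, so a single term
-- survives in the sum over `h`. Links with both ends at `x` are prepared locally and contribute
-- their EPR amplitudes here.
theorem extract_kraus_eq_ite (x : Fin N) (l : Bits (Halves N m x))
    (r : Bits {i // src i = x} × Bits {i // tgt i = x}) (h : Bits (Halves N m x))
    (h1 : ∀ i hs hi, h (⟨tgt i, hi⟩, f i) = r.1 ⟨i, hs⟩)
    (h2 : ∀ i ht hi, h (⟨src i, hi⟩, f i) = r.2 ⟨i, ht⟩)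
    (h3 : ∀ w, ¬ HalfUsed f src tgt x w → h w = l w) (h' : Bits (Halves N m x)) :
    (extract f src tgt x).kraus l r h' = if h' = h then
      (if ∀ w, HalfUsed f src tgt x w → l w = 0 then 1 else 0) *
        ∏ i : {i // src i = x}, (if hi : tgt i = x then eprPair (r.1 i) (r.2 ⟨i, hi⟩) else 1)
      else 0 := by
  rw [extract_kraus]
  split_ifs with e hl
  · subst e
    have e3 : ∏ w, restAmp f src tgt x h' w (l w) = 1 := Finset.prod_eq_one fun w _ => by
      by_cases hw : HalfUsed f src tgt x w
      · simp [restAmp, hw, hl w hw]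
      · simp [restAmp, hw, h3 w hw]
    rw [e3, mul_one, one_mul]
    have e1 : ∏ i, srcAmp f src tgt x h' i (r.1 i) = ∏ i, if src i = x ∧ tgt i = x then
        ((1 / Real.sqrt 2 : ℝ) : ℂ) else 1 := by
      rw [← Fintype.prod_subtype_mul_prod_subtype fun i => src i = x]
      rw [Finset.prod_eq_one (s := Finset.univ (α := {i // ¬ src i = x})), mul_one]
      · refine Finset.prod_congr rfl fun i _ => ?_
        by_cases hi : tgt i = x
        · simp [srcAmp, hi, i.2]
        · simp [srcAmp, hi, h1 i i.2 hi]
      · intro i _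
        simp [i.2]
    have e2 : ∏ i, tgtAmp f src tgt x h' r.1 i (r.2 i) = ∏ i, if hi : src i = x ∧ tgt i = x then
        (if r.2 ⟨i, hi.2⟩ = r.1 ⟨i, hi.1⟩ then (1 : ℂ) else 0) else 1 := by
      rw [← Fintype.prod_subtype_mul_prod_subtype fun i => tgt i = x]
      rw [Finset.prod_eq_one (s := Finset.univ (α := {i // ¬ tgt i = x})), mul_one]
      · refine Finset.prod_congr rfl fun i _ => ?_
        by_cases hi : src i = x
        · simp [tgtAmp, hi, i.2]
        · simp [tgtAmp, hi, h2 i i.2 hi]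
      · intro i _
        simp [i.2]
    have e4 : (∏ i : {i // src i = x}, if hi : tgt i = x then eprPair (r.1 i) (r.2 ⟨i, hi⟩) else 1)
        = ∏ i, if hi : src i = x ∧ tgt i = x then eprPair (r.1 ⟨i, hi.1⟩) (r.2 ⟨i, hi.2⟩)
          else 1 := by
      rw [← Fintype.prod_subtype_mul_prod_subtype fun i => src i = x]
      rw [Finset.prod_eq_one (s := Finset.univ (α := {i // ¬ src i = x})), mul_one]
      · refine Finset.prod_congr rfl fun i _ => ?_
        by_cases hi : tgt i = x
        · simp [hi, i.2]
        · simp [hi]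
      · intro i _
        simp [i.2]
    rw [e1, e2, e4, ← Finset.prod_mul_distrib]
    refine Finset.prod_congr rfl fun i _ => ?_
    by_cases hi : src i = x ∧ tgt i = x
    · simp [hi, eprPair, eq_comm]
    · simp [hi]
  · push Not at hl
    obtain ⟨w, hw, hw'⟩ := hl
    rw [Finset.prod_eq_zero (Finset.mem_univ w) (by simp [restAmp, hw, hw'])]
    simp
  · obtain ⟨w, hw⟩ := Function.ne_iff.1 e
    by_cases hu : HalfUsed f src tgt x w
    · obtain ⟨⟨q, hq⟩, a⟩ := w
      obtain ⟨i, rfl, ⟨hs, rfl⟩ | ⟨ht, rfl⟩⟩ := hu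
      · rw [h1 i hs hq] at hw
        rw [Finset.prod_eq_zero (Finset.mem_univ (⟨i, hs⟩ : {i // src i = x}))
          (by simp [srcAmp, hq, Ne.symm hw])]
        simp
      · rw [h2 i ht hq] at hw
        rw [Finset.prod_eq_zero (Finset.mem_univ (⟨i, ht⟩ : {i // tgt i = x}))
          (by simp [tgtAmp, hq, Ne.symm hw])]
        simp
    · rw [h3 w hu] at hw
      rw [Finset.prod_eq_zero (Finset.mem_univ w) (by simp [restAmp, hu, Ne.symm hw])]
      simp

end Extraction

section Extraction
variable {N m : ℕ}

/-- A link between different parties occupies exactly one of the shared pairs, whatever its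
orientation; a link within one party occupies none. -/
theorem prod_prod_ite_link {I : Type} [Fintype I] (f : I ↪ Fin m) (src tgt : I → Fin N)
    (G : I → ℂ) (i : I) :
    (∏ e : {e : Fin N × Fin N // e.1 < e.2}, ∏ a : Fin m,
      if f i = a ∧ ((src i = e.1.1 ∧ tgt i = e.1.2) ∨ (tgt i = e.1.1 ∧ src i = e.1.2)) then G i
        else 1) = if src i = tgt i then 1 else G i := by
  have h : ∀ e : {e : Fin N × Fin N // e.1 < e.2}, (∏ a : Fin m,
      if f i = a ∧ ((src i = e.1.1 ∧ tgt i = e.1.2) ∨ (tgt i = e.1.1 ∧ src i = e.1.2)) then G i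
        else 1) =
      if (src i = e.1.1 ∧ tgt i = e.1.2) ∨ (tgt i = e.1.1 ∧ src i = e.1.2) then G i else 1 := by
    intro e
    rw [Fintype.prod_eq_single (f i) fun a ha => if_neg fun h => ha h.1.symm]
    simp
  simp only [h]
  by_cases hi : src i = tgt i
  · rw [if_pos hi]
    refine Finset.prod_eq_one fun e _ => if_neg ?_
    rintro (⟨h1, h2⟩ | ⟨h1, h2⟩)
    · exact e.2.ne (by rw [← h1, ← h2, hi])
    · exact e.2.ne (by rw [← h1, ← h2, hi])
  · rw [if_neg hi]
    rcases lt_or_gt_of_ne hi with hlt | hlt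
    · rw [Fintype.prod_eq_single ⟨(src i, tgt i), hlt⟩]
      · simp
      · rintro ⟨⟨x, y⟩, hxy⟩ he
        refine if_neg ?_
        rintro (⟨rfl, rfl⟩ | ⟨rfl, rfl⟩)
        · exact he rfl
        · exact hlt.not_gt hxy
    · rw [Fintype.prod_eq_single ⟨(tgt i, src i), hlt⟩]
      · simp
      · rintro ⟨⟨x, y⟩, hxy⟩ he
        refine if_neg ?_
        rintro (⟨rfl, rfl⟩ | ⟨rfl, rfl⟩)
        · exact hlt.not_gt hxy
        · exact he rfl

open Classical in
/-- The amplitudes of the EPR pairs that are not used for the links. -/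
noncomputable def restState {I : Type} (f : I ↪ Fin m) (src tgt : I → Fin N)
    (l : ∀ x, Bits (Halves N m x)) : ℂ :=
  ∏ e : {e : Fin N × Fin N // e.1 < e.2}, ∏ a : Fin m,
    if HalfUsed f src tgt e.1.1 (⟨e.1.2, e.2.ne'⟩, a) then 1
    else eprPair (l e.1.1 (⟨e.1.2, e.2.ne'⟩, a)) (l e.1.2 (⟨e.1.1, e.2.ne⟩, a))

/-- The shared pairs split into those used as links and the measured rest. The factors of links
within one party are missing and are supplied by `extract`. -/
theorem eprState_eq {I : Type} [Fintype I] (f : I ↪ Fin m) (src tgt : I → Fin N)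
    (l h : ∀ x, Bits (Halves N m x)) (r : ∀ x, Bits {i // src i = x} × Bits {i // tgt i = x})
    (h1 : ∀ x i hs hi, h x (⟨tgt i, hi⟩, f i) = (r x).1 ⟨i, hs⟩)
    (h2 : ∀ x i ht hi, h x (⟨src i, hi⟩, f i) = (r x).2 ⟨i, ht⟩)
    (h3 : ∀ x w, ¬ HalfUsed f src tgt x w → h x w = l x w) :
    eprState N m h = (∏ i, if src i = tgt i then 1 else
      eprPair ((r (src i)).1 ⟨i, rfl⟩) ((r (tgt i)).2 ⟨i, rfl⟩)) * restState f src tgt l := by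
  simp only [← prod_prod_ite_link f src tgt
    (fun i => eprPair ((r (src i)).1 ⟨i, rfl⟩) ((r (tgt i)).2 ⟨i, rfl⟩))]
  rw [Finset.prod_comm, restState, eprState, ← Finset.prod_mul_distrib]
  refine Finset.prod_congr rfl fun e _ => ?_
  rw [Finset.prod_comm, ← Finset.prod_mul_distrib]
  refine Finset.prod_congr rfl fun a _ => ?_
  obtain ⟨⟨x, y⟩, hxy⟩ := e
  have hxy : x < y := hxy
  by_cases hu : HalfUsed f src tgt x (⟨y, hxy.ne'⟩, a)
  · rw [if_pos hu, mul_one]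
    obtain ⟨i, rfl, hi⟩ := hu
    rw [Fintype.prod_eq_single i fun i' hi' => if_neg fun h => hi' (f.injective h.1),
      if_pos ⟨rfl, hi⟩]
    rcases hi with ⟨rfl, rfl⟩ | ⟨rfl, rfl⟩
    · rw [h1 _ i rfl, h2 _ i rfl]
    · rw [h1 _ i rfl, h2 _ i rfl, eprPair_comm]
  · have hu' : ¬ HalfUsed f src tgt y (⟨x, hxy.ne⟩, a) := by
      rintro ⟨i, e, ⟨e1, e2⟩ | ⟨e1, e2⟩⟩
      · exact hu ⟨i, e, Or.inr ⟨e2, e1⟩⟩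
      · exact hu ⟨i, e, Or.inl ⟨e2, e1⟩⟩
    rw [if_neg hu, h3 _ _ hu, h3 _ _ hu', Finset.prod_eq_one, one_mul]
    exact fun i _ => if_neg fun h => hu ⟨i, h.1, h.2⟩

/-- A shared state that consists of EPR pairs is obtained by local operations from sufficiently many
EPR pairs between any two parties. -/
theorem IsLinkState.exists_extraction {R : Fin N → Type} [∀ x, Fintype (R x)]
    {ρ : (∀ x, R x) → ℂ} (hρ : IsLinkState ρ) :
    ∃ m₀, ∀ m ≥ m₀, ∃ (L : Fin N → Type) (_ : ∀ x, Fintype (L x))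
      (D : ∀ x, QuantumOperation (L x) (Bits (Halves N m x)) (R x)) (g : (∀ x, L x) → ℂ),
      ∀ l r, ∑ h, eprState N m h * ∏ x, (D x).kraus (l x) (r x) (h x) = g l * ρ r := by
  classical
  obtain ⟨I, _, _, src, tgt, e, hρ⟩ := hρ
  refine ⟨Fintype.card I, fun m hm => ?_⟩
  obtain ⟨f⟩ : Nonempty (I ↪ Fin m) := Function.Embedding.nonempty_of_card_le (by simpa using hm)
  refine ⟨fun x => Bits (Halves N m x), inferInstance, fun x =>
    .ofEntries (fun l r h => (extract f src tgt x).kraus l (e x r) h) fun h h' => ?_,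
    fun l => (if ∀ x w, HalfUsed f src tgt x w → l x w = 0 then 1 else 0) * restState f src tgt l,
    fun l r => ?_⟩
  · rw [← (extract f src tgt x).sum_star_mul]
    exact Finset.sum_congr rfl fun l _ => Fintype.sum_equiv (e x) _ _ fun _ => rfl
  · choose H h1 h2 h3 using fun x => exists_half_bits f src tgt x (l x) (e x (r x))
    change ∑ h, eprState N m h * ∏ x, (extract f src tgt x).kraus (l x) (e x (r x)) (h x) = _
    simp only [extract_kraus_eq_ite f src tgt _ _ _ (H _) (h1 _) (h2 _) (h3 _)]
    rw [Fintype.sum_eq_single H]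
    · simp only [if_true, Finset.prod_mul_distrib, Fintype.prod_boole,
        eprState_eq f src tgt l H (fun x => e x (r x)) h1 h2 h3, hρ, linkState]
      -- The links between different parties come from the shared pairs and the others from local
      -- preparation; together they give the whole link state.
      have key : (∏ i, if src i = tgt i then 1 else
          eprPair ((e _ (r (src i))).1 ⟨i, rfl⟩) ((e _ (r (tgt i))).2 ⟨i, rfl⟩)) *
          (∏ x, ∏ i : {i // src i = x}, if hi : tgt i = x then
            eprPair ((e x (r x)).1 i) ((e x (r x)).2 ⟨i, hi⟩) else 1) =
          ∏ i, eprPair ((e _ (r (src i))).1 ⟨i, rfl⟩) ((e _ (r (tgt i))).2 ⟨i, rfl⟩) := by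
        have h : ∀ x, (∏ i : {i // src i = x}, if hi : tgt i = x then
            eprPair ((e x (r x)).1 i) ((e x (r x)).2 ⟨i, hi⟩) else 1) =
            ∏ i, localPart src (fun i => if src i = tgt i then
              eprPair ((e _ (r (src i))).1 ⟨i, rfl⟩) ((e _ (r (tgt i))).2 ⟨i, rfl⟩) else 1) x i := by
          intro x
          refine Finset.prod_congr rfl fun i _ => ?_
          obtain ⟨i, rfl⟩ := i
          rw [localPart]
          by_cases hi : tgt i = src i
          · rw [dif_pos hi, if_pos hi.symm]
            congr 1
            have : ∀ x (hx : tgt i = x), (e x (r x)).2 ⟨i, hx⟩ = (e _ (r (tgt i))).2 ⟨i, rfl⟩ := by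
              rintro _ rfl
              rfl
            exact this _ hi
          · rw [dif_neg hi, if_neg (Ne.symm hi)]
        simp only [h]
        rw [prod_localPart src, ← Finset.prod_mul_distrib]
        refine Finset.prod_congr rfl fun i _ => ?_
        split_ifs <;> simp
      rw [← key]
      ring_nf
    · intro h hh
      obtain ⟨x, hx⟩ := Function.ne_iff.1 hh
      rw [Finset.prod_eq_zero (Finset.mem_univ x) (if_neg hx), mul_zero]

theorem sum_norm_sq_eprState (N m : ℕ) : ∑ h, ‖eprState N m h‖ ^ 2 = 1 := by
  let f : (∀ x, Bits (Halves N m x)) ≃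
      ({e : Fin N × Fin N // e.1 < e.2} × Fin m → Fin 2 × Fin 2) :=
    { toFun := fun h e => (h e.1.1.1 (⟨e.1.1.2, e.1.2.ne'⟩, e.2), h e.1.1.2 (⟨e.1.1.1, e.1.2.ne⟩, e.2))
      invFun := fun g x w => if hx : x < w.1.1 then (g (⟨(x, w.1.1), hx⟩, w.2)).1
        else (g (⟨(w.1.1, x), lt_of_le_of_ne (not_lt.1 hx) w.1.2⟩, w.2)).2
      left_inv := fun h => by
        funext x w
        by_cases hx : x < w.1.1
        · exact dif_pos hx
        · exact dif_neg hx
      right_inv := fun g => by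
        funext q
        obtain ⟨⟨⟨x, y⟩, hxy⟩, a⟩ := q
        have hxy : x < y := hxy
        exact Prod.ext (dif_pos hxy) (dif_neg hxy.not_gt) }
  rw [Fintype.sum_equiv f _ (fun g => ∏ i, ‖eprPair (g i).1 (g i).2‖ ^ 2)]
  · rw [← Fintype.prod_sum (fun (_ : {e : Fin N × Fin N // e.1 < e.2} × Fin m)
      (q : Fin 2 × Fin 2) => ‖eprPair q.1 q.2‖ ^ 2)]
    simp [sum_norm_sq_eprPair]
  · intro h
    simp only [eprState, norm_prod, Finset.prod_pow, Fintype.prod_prod_type]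
    rfl

end Extraction

/-! ### From protocols to the operations of the theorem -/

section Assembly
variable {N : ℕ} {n : Fin N → ℕ}

/-- The location of the data qubits. -/
abbrev owner (n : Fin N → ℕ) : (Σ p, Fin (n p)) → Fin N := Sigma.fst

/-- Basis labels of all data qubits, party by party. -/
def dataEquiv (n : Fin N → ℕ) : Bits (Σ p, Fin (n p)) ≃ ∀ p, DataReg (n p) where
  toFun s p i := s ⟨p, i⟩
  invFun t j := t j.1 j.2
  left_inv _ := rfl
  right_inv _ := rfl

/-- Basis labels of the data qubits of party `p`. -/
def ownEquiv (n : Fin N → ℕ) (p : Fin N) : DataReg (n p) ≃ Bits {j // owner n j = p} where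
  toFun s j := s (Equiv.sigmaSubtype p j)
  invFun t i := t ⟨⟨p, i⟩, rfl⟩
  left_inv _ := rfl
  right_inv t := by
    funext j
    obtain ⟨⟨q, i⟩, rfl⟩ := j
    rfl

theorem ownEquiv_dataEquiv (s : Bits (Σ p, Fin (n p))) (p : Fin N) :
    ownEquiv n p (dataEquiv n s p) = localPart (owner n) s p := by
  funext j
  obtain ⟨⟨q, i⟩, rfl⟩ := j
  rfl

/-- Extract the shared state from EPR pairs by the operations `D` and execute `A` with the input
`z`, which is returned as a part of the outcome. -/
noncomputable def Protocol.realize {m : ℕ} {Z : Fin N → Type} [∀ p, Fintype (Z p)]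
    [∀ p, DecidableEq (Z p)] (A : Protocol (owner n) (owner n) Z) {L : Fin N → Type}
    [∀ p, Fintype (L p)] (D : ∀ p, QuantumOperation (L p) (Bits (Halves N m p)) (A.R p)) (p : Fin N)
    (z : Z p) :
    QuantumOperation (A.K p × L p × Z p) (LocalReg N m n p) (DataReg (n p)) :=
  .ofEntries (fun k t q => if k.2.2 = z then ∑ i, (A.op p z).kraus k.1 (ownEquiv n p t) i *
      (if i.1 = ownEquiv n p q.1 then (D p).kraus k.2.1 i.2 q.2 else 0) else 0) (by
    rintro ⟨s, h⟩ ⟨s', h'⟩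
    have e : ∀ (l : L p), ∑ k, ∑ t, star (∑ i, (A.op p z).kraus k (ownEquiv n p t) i *
        (if i.1 = ownEquiv n p s then (D p).kraus l i.2 h else 0)) *
        (∑ i, (A.op p z).kraus k (ownEquiv n p t) i *
        (if i.1 = ownEquiv n p s' then (D p).kraus l i.2 h' else 0)) =
        if s = s' then ∑ r, star ((D p).kraus l r h) * (D p).kraus l r h' else 0 := by
      intro l
      let F : DataReg (n p) → Bits (Halves N m p) → Bits {j // owner n j = p} × A.R p → ℂ :=
        fun s h i => if i.1 = ownEquiv n p s then (D p).kraus l i.2 h else 0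
      refine ((Finset.sum_congr rfl fun k _ => Fintype.sum_equiv (ownEquiv n p) _ _ fun _ =>
        rfl).trans ((A.op p z).sum_star_sum_mul_sum (F s h) (F s' h'))).trans ?_
      rw [Fintype.sum_prod_type, Fintype.sum_eq_single (ownEquiv n p s)]
      · by_cases hs : s = s' <;> simp [F, hs]
      · intro t ht
        simp [F, ht]
    rw [Fintype.sum_prod_type, Finset.sum_congr rfl fun k _ => Fintype.sum_prod_type _,
      Finset.sum_comm]
    calc _ = ∑ l, if s = s' then ∑ r, star ((D p).kraus l r h) * (D p).kraus l r h' else 0 := by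
          refine Finset.sum_congr rfl fun l _ => ?_
          rw [← e]
          refine Finset.sum_congr rfl fun k _ => ?_
          rw [Fintype.sum_eq_single z]
          · simp
          · intro z' hz
            simp [hz]
      _ = _ := by
          by_cases hs : s = s'
          · simp only [hs, if_true, QuantumOperation.sum_star_mul]
            simp
          · simp [hs])

variable {E : Type v} [NormedAddCommGroup E] [InnerProductSpace ℂ E]

/-- By `hg` the extraction delivers `A.state` up to the scalar `g l`, so the joint operator is that
of `A`, provided that the reported inputs are the actual ones. -/
theorem Protocol.jointOutput_realize {m : ℕ} {Z : Fin N → Type} [∀ p, Fintype (Z p)]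
    [∀ p, DecidableEq (Z p)] (A : Protocol (owner n) (owner n) Z) {L : Fin N → Type}
    [∀ p, Fintype (L p)] (D : ∀ p, QuantumOperation (L p) (Bits (Halves N m p)) (A.R p))
    {g : (∀ p, L p) → ℂ}
    (hg : ∀ l r, ∑ h, eprState N m h * ∏ x, (D x).kraus (l x) (r x) (h x) = g l * A.state r)
    (ψ : StateSpace (∀ p, DataReg (n p)) E) (z : ∀ p, Z p) (k : ∀ p, A.K p) (l : ∀ p, L p)
    (z' : ∀ p, Z p) :
    jointOutput (fun p => A.realize D p (z p)) ψ (fun p => (k p, l p, z' p)) =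
      (if z' = z then g l else 0) •
        applyMatrix ((A.eff z k).submatrix (dataEquiv n).symm (dataEquiv n).symm) ψ := by
  ext t
  change ∑ q : ∀ p, DataReg (n p) × Bits (Halves N m p), (∏ p, if z' p = z p then
    ∑ i : Bits {j // owner n j = p} × A.R p, (A.op p (z p)).kraus (k p) (ownEquiv n p (t p)) i *
      (if i.1 = ownEquiv n p (q p).1 then (D p).kraus (l p) i.2 (q p).2 else 0) else 0) •
    (eprState N m (fun p => (q p).2) • ψ fun p => (q p).1) = _
  by_cases hz : z' = z
  swap
  · obtain ⟨p, hp⟩ := Function.ne_iff.1 hz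
    rw [if_neg hz, zero_smul]
    refine Finset.sum_eq_zero fun q _ => ?_
    rw [Finset.prod_eq_zero (Finset.mem_univ p) (if_neg hp), zero_smul]
  subst hz
  rw [if_pos rfl, ← applyMatrix_smul, sum_pi_prod]
  change _ = ∑ s, (g l * A.eff z' k ((dataEquiv n).symm t) ((dataEquiv n).symm s)) • ψ s
  refine Finset.sum_congr rfl fun s _ => ?_
  simp only [smul_smul, ← Finset.sum_smul, if_true]
  congr 1
  have e : ∀ (h : ∀ p, Bits (Halves N m p)) p, (∑ i : Bits {j // owner n j = p} × A.R p,
      (A.op p (z' p)).kraus (k p) (ownEquiv n p (t p)) i *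
      (if i.1 = ownEquiv n p (s p) then (D p).kraus (l p) i.2 (h p) else 0)) =
      ∑ r, (A.op p (z' p)).kraus (k p) (ownEquiv n p (t p)) (ownEquiv n p (s p), r) *
        (D p).kraus (l p) r (h p) := by
    intro h p
    rw [Fintype.sum_prod_type, Fintype.sum_eq_single (ownEquiv n p (s p))]
    · simp
    · intro t ht
      simp [ht]
  simp only [e, Fintype.prod_sum, Finset.sum_mul, Finset.prod_mul_distrib]
  rw [Finset.sum_comm]
  simp only [Protocol.eff, Finset.mul_sum, ← mul_assoc, ← hg, Finset.sum_mul]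
  refine Finset.sum_congr rfl fun r _ => Finset.sum_congr rfl fun h _ => ?_
  have e' : ∀ (s : ∀ p, DataReg (n p)) p,
      localPart (owner n) ((dataEquiv n).symm s) p = ownEquiv n p (s p) := by
    intro s p
    rw [← ownEquiv_dataEquiv, Equiv.apply_symm_apply]
  simp only [e']
  ring

open Classical in
/-- The failure probability is at most the weight that is left by outcomes with a correct output
state. -/
theorem failureProb_le {m : ℕ} {K : Fin N → Type} [∀ p, Fintype (K p)]
    (A : ∀ p, QuantumOperation (K p) (LocalReg N m n p) (DataReg (n p)))
    (V : (∀ p, K p) → ∀ p, Fin (n p) → Matrix.unitaryGroup (Fin 2) ℂ)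
    (ψ φ : StateSpace (∀ p, DataReg (n p)) E) (hψ : ‖ψ‖ = 1) (γ : (∀ p, K p) → ℂ)
    (h : ∀ k, γ k = 0 ∨ CoincidesUpTo (V k) (jointOutput A ψ k) φ ∧ ‖jointOutput A ψ k‖ = ‖γ k‖) :
    failureProb A V ψ φ ≤ 1 - ∑ k, ‖γ k‖ ^ 2 := by
  have h1 : ‖withEPR m ψ‖ ^ 2 = 1 := by
    rw [PiLp.norm_sq_eq_of_L2]
    change ∑ q : ∀ p, DataReg (n p) × Bits (Halves N m p),
      ‖eprState N m (fun p => (q p).2) • ψ fun p => (q p).1‖ ^ 2 = 1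
    rw [sum_pi_prod]
    simp only [norm_smul, mul_pow, ← Finset.sum_mul, sum_norm_sq_eprState, one_mul]
    rw [← PiLp.norm_sq_eq_of_L2 (fun _ => E) ψ, hψ, one_pow]
  have h2 : ∑ k, ‖jointOutput A ψ k‖ ^ 2 = 1 := h1 ▸ sum_norm_sq_tensorMatrix A (withEPR m ψ)
  rw [← h2, ← Finset.sum_sub_distrib, failureProb, Finset.sum_filter]
  refine Finset.sum_le_sum fun k _ => ?_
  rcases h k with h | ⟨h, h'⟩
  · rw [h]
    split_ifs <;> simp
  · simp [h, h']

theorem qubitwise_eq (w : (Σ p, Fin (n p)) → Matrix.unitaryGroup (Fin 2) ℂ) :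
    qubitwise (fun p i => w ⟨p, i⟩) =
      (reindexUnitary (dataEquiv n) (tensorUnitary w) : Matrix _ _ ℂ) := by
  ext t s
  simp only [qubitwise, tensorMatrix, coe_reindexUnitary, Matrix.submatrix_apply,
    coe_tensorUnitary, Fintype.prod_sigma]
  rfl

theorem Solvable.exists_operations {Z : Fin N → Type} [∀ p, Fintype (Z p)]
    {W : (∀ p, Z p) → Matrix.unitaryGroup (Bits (Σ p, Fin (n p))) ℂ} {ε : ℝ}
    (h : Solvable (owner n) (owner n) Z W fun _ => ε) :
    ∃ m₀ : ℕ, ∀ m ≥ m₀, ∃ (K : Fin N → Type) (_ : ∀ p, Fintype (K p))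
      (A : ∀ p, Z p → QuantumOperation (K p) (LocalReg N m n p) (DataReg (n p)))
      (V : (∀ p, K p) → ∀ p, Fin (n p) → Matrix.unitaryGroup (Fin 2) ℂ),
      ∀ (E : Type v) [NormedAddCommGroup E] [InnerProductSpace ℂ E]
        (ψ : StateSpace (∀ p, DataReg (n p)) E), ‖ψ‖ = 1 → ∀ z : ∀ p, Z p,
        failureProb (fun p => A p (z p)) V ψ (applyMatrix
          (reindexUnitary (dataEquiv n) (W z) : Matrix _ _ ℂ) ψ) ≤ ε := by
  classical
  obtain ⟨A, c, h, hc⟩ := h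
  obtain ⟨m₀, hm₀⟩ := A.isLinkState.exists_extraction
  refine ⟨m₀, fun m hm => ?_⟩
  obtain ⟨L, _, D, g, hg⟩ := hm₀ m hm
  -- The correction has to be defined for failed outcomes as well, where it is arbitrary.
  have hv : ∀ (z : ∀ p, Z p) (k : ∀ p, A.K p),
      ∃ v : (Σ p, Fin (n p)) → Matrix.unitaryGroup (Fin 2) ℂ,
      c z k ≠ 0 → A.eff z k = c z k • ((tensorUnitary v * W z : Matrix.unitaryGroup _ ℂ) :
        Matrix (Bits (Σ p, Fin (n p))) (Bits (Σ p, Fin (n p))) ℂ) := by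
    intro z k
    rcases h z k with h | ⟨_, ⟨v, rfl⟩, h⟩
    · exact ⟨1, fun h' => (h' h).elim⟩
    · exact ⟨v, fun _ => h⟩
  choose v hv using hv
  -- Extraction maps one unit vector to multiples `g l` of another, so conservation of probability
  -- normalizes `g`.
  have hg1 : ∑ l, ‖g l‖ ^ 2 = 1 := by
    have h1 := sum_norm_sq_tensorMatrix D
      (WithLp.toLp 2 (eprState N m) : StateSpace (∀ p, Bits (Halves N m p)) ℂ)
    rw [PiLp.norm_sq_eq_of_L2] at h1
    refine Eq.trans ?_ (h1.trans (sum_norm_sq_eprState N m))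
    refine Finset.sum_congr rfl fun l _ => ?_
    rw [PiLp.norm_sq_eq_of_L2]
    have e : ∀ r, applyMatrix (tensorMatrix fun p => (D p).kraus (l p))
        (WithLp.toLp 2 (eprState N m) : StateSpace (∀ p, Bits (Halves N m p)) ℂ) r =
        g l * A.state r := by
      intro r
      rw [← hg]
      exact Finset.sum_congr rfl fun h _ => mul_comm _ _
    simp only [e, norm_mul, mul_pow, ← Finset.mul_sum, A.isLinkState.sum_norm_sq, mul_one]
  -- The outcome contains the input because the correction `v` depends on it. The protocol yields `V
  -- * W z`, so the final unitary is the inverse of `V`.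
  refine ⟨fun p => A.K p × L p × Z p, inferInstance, fun p z => A.realize D p z,
    fun k p i => (v (fun p => (k p).2.2) (fun p => (k p).1) ⟨p, i⟩)⁻¹, fun E _ _ ψ hψ z => ?_⟩
  refine (failureProb_le _ _ ψ _ hψ (fun k => (if (fun p => (k p).2.2) = z then
    g (fun p => (k p).2.1) else 0) * c z fun p => (k p).1) fun k => ?_).trans ?_
  · generalize hk1 : (fun p => (k p).1) = k1
    generalize hk2 : (fun p => (k p).2.1) = l
    generalize hk3 : (fun p => (k p).2.2) = z'
    have hk : k = fun p => (k1 p, l p, z' p) := by rw [← hk1, ← hk2, ← hk3]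
    by_cases hz : z' = z
    swap
    · left
      rw [if_neg hz, zero_mul]
    by_cases hck : c z k1 = 0
    · left
      rw [hck, mul_zero]
    right
    rw [hk, A.jointOutput_realize D hg ψ z k1 l z', if_pos hz, hz, hv z k1 hck,
      Matrix.submatrix_smul, Pi.smul_apply, Pi.smul_apply, ← applyMatrix_smul, smul_smul,
      ← coe_reindexUnitary]
    refine ⟨⟨g l * c z k1, ?_⟩, ?_⟩
    · rw [← applyMatrix_mul, Matrix.mul_smul, applyMatrix_smul]
      congr 2
      refine (congrArg (· * _) (qubitwise_eq fun j => (v z k1 j)⁻¹)).trans ?_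
      have : tensorUnitary (fun j => (v z k1 j)⁻¹) = (tensorUnitary (v z k1))⁻¹ :=
        map_inv tensorUnitary (v z k1)
      rw [← Submonoid.coe_mul, ← map_mul, this, inv_mul_cancel_left]
    · rw [applyMatrix_smul, norm_smul, norm_applyMatrix_unitary, hψ, mul_one]
  · have e : ∑ k : ∀ p, A.K p × L p × Z p, ‖(if (fun p => (k p).2.2) = z then
        g (fun p => (k p).2.1) else 0) * c z (fun p => (k p).1)‖ ^ 2 = ∑ k, ‖c z k‖ ^ 2 := by
      rw [sum_pi_prod]
      refine Finset.sum_congr rfl fun k _ => ?_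
      rw [sum_pi_prod]
      simp only [norm_mul, mul_pow, ← Finset.sum_mul]
      have e' : ∀ l, ∑ z', ‖if z' = z then g l else 0‖ ^ 2 = ‖g l‖ ^ 2 := by
        intro l
        rw [Fintype.sum_eq_single z fun z' hz => by simp [hz]]
        simp
      simp only [e', hg1, one_mul]
    rw [e]
    linarith [hc z]

end Assembly

/-! ### The case without parties and the theorem -/

theorem exists_applyMatrix_eq_smul {ι E : Type*} [Fintype ι] [Unique ι] [AddCommGroup E] [Module ℂ E]
    (M : Matrix ι ι ℂ) (ψ : StateSpace ι E) : ∃ d : ℂ, applyMatrix M ψ = d • ψ := by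
  refine ⟨M default default, ?_⟩
  ext a
  rw [Subsingleton.elim a default]
  simp [applyMatrix]

/-- Without parties the data space is one-dimensional, so every operator is a scalar. -/
theorem coincidesUpTo_of_isEmpty {n : Fin 0 → ℕ} {E : Type v} [NormedAddCommGroup E]
    [InnerProductSpace ℂ E] {m : ℕ} {K : Fin 0 → Type} [∀ p, Fintype (K p)]
    (A : ∀ p, QuantumOperation (K p) (LocalReg 0 m n p) (DataReg (n p)))
    (V : ∀ p, Fin (n p) → Matrix.unitaryGroup (Fin 2) ℂ) (k : ∀ p, K p)
    (U : Matrix.unitaryGroup (∀ p, DataReg (n p)) ℂ) (ψ : StateSpace (∀ p, DataReg (n p)) E) :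
    CoincidesUpTo V (jointOutput A ψ k)
      (applyMatrix (U : Matrix (∀ p, DataReg (n p)) (∀ p, DataReg (n p)) ℂ) ψ) := by
  obtain ⟨d, hd⟩ := exists_applyMatrix_eq_smul
    ((U⁻¹ : Matrix.unitaryGroup (∀ p, DataReg (n p)) ℂ) : Matrix (∀ p, DataReg (n p)) _ ℂ)
    (applyMatrix (U : Matrix (∀ p, DataReg (n p)) (∀ p, DataReg (n p)) ℂ) ψ)
  rw [← applyMatrix_mul, ← Submonoid.coe_mul, inv_mul_cancel, OneMemClass.coe_one,
    applyMatrix_one] at hd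
  obtain ⟨d', hd'⟩ := exists_applyMatrix_eq_smul (qubitwise V) (jointOutput A ψ k)
  have h : ∃ d : ℂ, jointOutput A ψ k = d • ψ := by
    let q : ∀ p, LocalReg 0 m n p := fun p => p.elim0
    refine ⟨tensorMatrix (fun p => (A p).kraus (k p)) (fun p => p.elim0) q *
      eprState 0 m fun p => (q p).2, ?_⟩
    ext a
    obtain rfl : a = fun p => p.elim0 := Subsingleton.elim _ _
    rw [PiLp.smul_apply, mul_smul]
    change ∑ q, tensorMatrix (fun p => (A p).kraus (k p)) (fun p => p.elim0) q • withEPR m ψ q = _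
    rw [Fintype.sum_subsingleton _ q]
    change _ • _ • ψ (fun p => (q p).1) = _
    rw [Subsingleton.elim (fun p => (q p).1) fun p => p.elim0]
  obtain ⟨d'', hd''⟩ := h
  refine ⟨d' * d'' * d, ?_⟩
  rw [hd', hd'', mul_smul, ← hd, mul_smul]

/-- Party `0` is Alice with `A` and `x`; party `p ≥ 1` is the user with `B_p` and `y_p`. Party `p`
has `n p` data qubits and a classical input in the finite set `X p`. -/
theorem mainTheorem6 (N : ℕ) (n : Fin N → ℕ) (X : Fin N → Type u) [∀ p, Finite (X p)]
    (U : (∀ p, X p) → Matrix.unitaryGroup (∀ p, DataReg (n p)) ℂ) (ε : ℝ) (hε : 0 < ε) :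
    ∃ m₀ : ℕ, ∀ m ≥ m₀,
      ∃ (K : Fin N → Type) (_ : ∀ p, Fintype (K p))
        (A : ∀ p, X p → QuantumOperation (K p) (LocalReg N m n p) (DataReg (n p)))
        (V : (∀ p, K p) → ∀ p, Fin (n p) → Matrix.unitaryGroup (Fin 2) ℂ),
        ∀ (E : Type v) [NormedAddCommGroup E] [InnerProductSpace ℂ E]
          (ψ : StateSpace (∀ p, DataReg (n p)) E), ‖ψ‖ = 1 →
          ∀ x : ∀ p, X p,
            failureProb (fun p => A p (x p)) V ψ
              (applyMatrix (U x : Matrix (∀ p, DataReg (n p)) (∀ p, DataReg (n p)) ℂ) ψ) ≤ ε := by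
  rcases Nat.eq_zero_or_pos N with rfl | hN
  · refine ⟨0, fun m _ => ⟨fun _ => Unit, inferInstance, fun p => p.elim0, fun _ p => p.elim0,
      fun E _ _ ψ _ x => ?_⟩⟩
    classical
    rw [failureProb]
    refine (Finset.sum_eq_zero fun k hk => ?_).trans_le hε.le
    exact ((Finset.mem_filter.1 hk).2 (coincidesUpTo_of_isEmpty _ _ _ _ _)).elim
  -- `Protocol` takes inputs from types in the lowest universe, so the finite sets `X p` are
  -- replaced by `Fin (Nat.card (X p))`.
  · let e : ∀ p, X p ≃ Fin (Nat.card (X p)) := fun p => Finite.equivFin (X p)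
    obtain ⟨m₀, h⟩ := (solvable_of_pos ⟨0, hN⟩ (owner n) (fun p => Fin (Nat.card (X p)))
      (fun z => reindexUnitary (dataEquiv n).symm (U fun p => (e p).symm (z p)))
      hε).exists_operations
    refine ⟨m₀, fun m hm => ?_⟩
    obtain ⟨K, hK, A, V, h⟩ := h m hm
    refine ⟨K, hK, fun p x => A p (e p x), V, fun E _ _ ψ hψ x => ?_⟩
    have h := h E ψ hψ fun p => e p (x p)
    have hU : (reindexUnitary (dataEquiv n) (reindexUnitary (dataEquiv n).symm
        (U fun p => (e p).symm (e p (x p))))).1 = (U x).1 := by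
      simp
    rwa [hU] at h
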